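/- Let $L$ be an SPS lattice, that is, a planar (hence finite) upper semimodular lattice with no sublattice isomorphic to $M_3$. Let $S=\{o,a_l,a_r,i\}$ be a covering square of $L$ ($o\prec a_l\prec i$, $o\prec a_r\prec i$, $a_l\neq a_r$) that is tight, that is, $a_l$ and $a_r$ are the only elements of $L$ covered by $i$. Let $L[S]$ be obtained from $L$ by inserting a fork at $S$: put $x_{l,1}=a_l$, $y_{l,1}=o$, and, as long as there is an $x_{l,k+1}\in L$ such that $\{y_{l,k+1}=x_{l,k+1}\wedge y_{l,k},\ x_{l,k+1},\ y_{l,k},\ x_{l,k}\}$ is a covering square of $L$ with top $x_{l,k}$, continue with the pair $(y_{l,k+1},x_{l,k+1})$; define $x_{r,k},y_{r,k}$ in the same way starting from $x_{r,1}=a_r$, $y_{r,1}=o$. Add to $L$ new elements $t$, $z_{l,k}$, $z_{r,k}$ (one for each $k$ for which $x_{l,k}$, respectively $x_{r,k}$, is defined), and let the order be generated by that of $L$ together with $z_{l,1}<t$, $z_{r,1}<t$, $t<i$, and, for $s\in\{l,r\}$, $y_{s,k}<z_{s,k}<x_{s,k}$ and $z_{s,k+1}<z_{s,k}$. Then $L[S]$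 is a lattice. Write $\operatorname{con}(a,b)$ for the smallest congruence of $L[S]$ collapsing $a$ and $b$, and let $\gamma(S)=\operatorname{con}(t,i)$, $\overline{\alpha}_l(S)=\operatorname{con}(a_l,i)$, $\overline{\alpha}_r(S)=\operatorname{con}(a_r,i)$. These three congruences are join-irreducible, and in the ordered set $\operatorname{Ji}(\operatorname{Con} L[S])$ of join-irreducible congruences of $L[S]$ the covers of $\gamma(S)$ are exactly the minimal elements of $\{\overline{\alpha}_l(S),\overline{\alpha}_r(S)\}$. In particular, $\gamma(S)$ has one or two covers there: both $\overline{\alpha}_l(S)$ and $\overline{\alpha}_r(S)$ are covers (possibly equal), unless one of them is strictly below the other, and then the smaller one is the only cover. -/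

import Mathlib

/-! ### Slim, planar, semimodular lattices -/

/-- A finite ordered set is planar if it has a planar (Hasse) diagram: the elements are distinct
points of the plane, smaller elements are drawn lower, every covering pair is joined by a straight
line segment, and two different such segments meet at most in a common endpoint. -/
def IsPlanar (P : Type*) [PartialOrder P] : Prop :=
  Finite P ∧ ∃ pos : P → ℝ × ℝ, Function.Injective pos ∧
    (∀ a b : P, a < b → (pos a).2 < (pos b).2) ∧
    ∀ a b c d : P, a ⋖ b → c ⋖ d → (a, b) ≠ (c, d) →
      segment ℝ (pos a) (pos b) ∩ segment ℝ (pos c) (pos d) ⊆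
        pos '' (({a, b} : Set P) ∩ {c, d})

/-- A lattice is slim if it has no five-element sublattice `{o, a, b, c, i}` isomorphic to `M₃`. -/
def IsSlim (L : Type*) [Lattice L] : Prop :=
  ¬ ∃ o a b c i : L, a ≠ b ∧ a ≠ c ∧ b ≠ c ∧
    a ⊓ b = o ∧ a ⊓ c = o ∧ b ⊓ c = o ∧ a ⊔ b = i ∧ a ⊔ c = i ∧ b ⊔ c = i

/-- SPS lattices: slim, planar (in particular finite), (upper) semimodular lattices. -/
structure IsSPS (L : Type*) [Lattice L] : Prop where
  slim : IsSlim L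
  planar : IsPlanar L
  semimodular : IsUpperModularLattice L

/-! ### Covering squares -/

/-- `{o, a, b, i}` is a covering square with bottom `o`, top `i` and the two middle elements
`a ≠ b` (so that `o = a ⊓ b` and `i = a ⊔ b`). -/
def IsCoveringSquare {L : Type*} [Lattice L] (o a b i : L) : Prop :=
  o ⋖ a ∧ o ⋖ b ∧ a ⋖ i ∧ b ⋖ i ∧ a ≠ b

/-- A covering square `S = {o, a_l, a_r, i}` of `L`. -/
structure CoveringSquare (L : Type*) [Lattice L] where
  /-- the bottom -/
  o : L
  /-- the left middle element -/
  al : L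
  /-- the right middle element -/
  ar : L
  /-- the top -/
  i : L
  isCoveringSquare : IsCoveringSquare o al ar i

/-- `S` is tight if its top `i` covers exactly two elements of `L`, namely `a_l` and `a_r`. -/
def CoveringSquare.IsTight {L : Type*} [Lattice L] (S : CoveringSquare L) : Prop :=
  ∀ x : L, x ⋖ S.i ↔ x = S.al ∨ x = S.ar

/-! ### Inserting a fork -/

/-- `ForkTrace o a y x` says that `(y, x)` is one of the pairs `(y₁, x₁), (y₂, x₂), …`, where
`(y₁, x₁) = (o, a)` and `(yₖ₊₁, xₖ₊₁)` is obtained from `(yₖ, xₖ)` whenever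
`{yₖ₊₁ = xₖ₊₁ ⊓ yₖ, xₖ₊₁, yₖ, xₖ}` is a covering square of `L`. -/
inductive ForkTrace {L : Type*} [Lattice L] (o a : L) : L → L → Prop
  | base : ForkTrace o a o a
  | step {y x x' : L} (h : ForkTrace o a y x) (hT : IsCoveringSquare (x' ⊓ y) x' y x) :
      ForkTrace o a (x' ⊓ y) x'

/-- The elements of `L[S]`: the elements of `L`, the new element `t`, and the new elements
`z_{l,k}` and `z_{r,k}`; the element `z_{l,k}` (resp. `z_{r,k}`) is named by the edge
`y_{l,k} ⋖ x_{l,k}` (resp. `y_{r,k} ⋖ x_{r,k}`) of `L` that it subdivides. -/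
inductive Fork {L : Type*} [Lattice L] (S : CoveringSquare L) : Type _
  | old (a : L) : Fork S
  | t : Fork S
  | zl (y x : L) (h : ForkTrace S.o S.al y x) : Fork S
  | zr (y x : L) (h : ForkTrace S.o S.ar y x) : Fork S

/-- The order relations imposed when the fork is inserted: those of `L`, the relations
`z_{l,1} < t`, `z_{r,1} < t`, `t < i`, and, on both sides, `y_k < z_k < x_k`, `z_{k+1} < z_k`. -/
inductive Fork.Step {L : Type*} [Lattice L] (S : CoveringSquare L) : Fork S → Fork S → Prop
  | old {a b : L} (h : a ≤ b) : Fork.Step S (.old a) (.old b)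
  | t_lt_i : Fork.Step S .t (.old S.i)
  | zl_lt_t : Fork.Step S (.zl S.o S.al .base) .t
  | zr_lt_t : Fork.Step S (.zr S.o S.ar .base) .t
  | y_lt_zl {y x : L} (h : ForkTrace S.o S.al y x) : Fork.Step S (.old y) (.zl y x h)
  | y_lt_zr {y x : L} (h : ForkTrace S.o S.ar y x) : Fork.Step S (.old y) (.zr y x h)
  | zl_lt_x {y x : L} (h : ForkTrace S.o S.al y x) : Fork.Step S (.zl y x h) (.old x)
  | zr_lt_x {y x : L} (h : ForkTrace S.o S.ar y x) : Fork.Step S (.zr y x h) (.old x)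
  | zl_lt_zl {y x x' : L} (h : ForkTrace S.o S.al y x)
      (hT : IsCoveringSquare (x' ⊓ y) x' y x) :
      Fork.Step S (.zl (x' ⊓ y) x' (h.step hT)) (.zl y x h)
  | zr_lt_zr {y x x' : L} (h : ForkTrace S.o S.ar y x)
      (hT : IsCoveringSquare (x' ⊓ y) x' y x) :
      Fork.Step S (.zr (x' ⊓ y) x' (h.step hT)) (.zr y x h)

/-- The order of `L[S]`: the reflexive and transitive closure of the imposed relations. -/
def Fork.Le {L : Type*} [Lattice L] {S : CoveringSquare L} (u v : Fork S) : Prop :=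
  Relation.ReflTransGen (Fork.Step S) u v

/-! ### The congruence lattice -/

/-- Congruences are ordered by inclusion. -/
instance LatticeCon.instPartialOrder {K : Type*} [Lattice K] : PartialOrder (LatticeCon K) where
  le θ φ := ∀ x y : K, θ.r x y → φ.r x y
  le_refl _ _ _ h := h
  le_trans _ _ _ h₁ h₂ x y h := h₂ x y (h₁ x y h)
  le_antisymm θ φ h₁ h₂ := by
    rcases θ with ⟨⟨r, e⟩, i, s⟩
    rcases φ with ⟨⟨r', e'⟩, i', s'⟩
    have hr : r = r' := by
      funext x y
      exact propext ⟨h₁ x y, h₂ x y⟩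
    subst hr
    rfl

/-- The intersection of a set of congruences. -/
instance LatticeCon.instInfSet {K : Type*} [Lattice K] : InfSet (LatticeCon K) where
  sInf A :=
    { r := fun x y => ∀ θ ∈ A, θ.r x y
      iseqv := ⟨fun x θ _ => θ.iseqv.refl x, fun h θ hθ => θ.iseqv.symm (h θ hθ),
        fun h h' θ hθ => θ.iseqv.trans (h θ hθ) (h' θ hθ)⟩
      inf := fun h h' θ hθ => θ.inf (h θ hθ) (h' θ hθ)
      sup := fun h h' θ hθ => θ.sup (h θ hθ) (h' θ hθ) }

/-- The congruence lattice `Con K`. -/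
instance LatticeCon.instCompleteLattice {K : Type*} [Lattice K] :
    CompleteLattice (LatticeCon K) :=
  completeLatticeOfInf _ fun _ =>
    ⟨fun _ hθ _ _ h => h _ hθ, fun _ hφ x y h _ hθ => hφ hθ x y h⟩

/-- `con(a, b)`, the smallest congruence of `K` collapsing `a` and `b`. -/
def LatticeCon.con {K : Type*} [Lattice K] (a b : K) : LatticeCon K :=
  sInf {θ : LatticeCon K | θ.r a b}

/-- `Ji (Con K)`, the ordered set of join-irreducible congruences of `K`. -/
abbrev JiCon (K : Type*) [Lattice K] : Type _ :=
  {θ : LatticeCon K // SupIrred θ}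

/-! Write γ, α_l, α_r for the three congruences. Two facts suffice: γ lies strictly below α_l and
α_r, and a join-irreducible congruence strictly above γ lies above α_l or α_r. Then
`setOf_covBy_eq_setOf_minimal` identifies the covers.

Apart from finiteness, planarity enters only through order dimension two: of three pairwise
incomparable elements, one lies between the meet and the join of the others. With semimodularity and
slimness this gives two covers at most for every element, and `IsSPS.le_or_le_or_le_sup`.

Call an element of L[S] low if it is below t. By `Fork.le_iff`, the least element of L above u
together with the lowness of u embeds L[S] as an ordered set into L × 2. All computations in L[S] go
through this embedding.

Collapsing a_l and i collapses t and i by a direct computation (`Fork.rel_t_i_of_rel`). For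
strictness, `Fork.not_con_rel` exhibits a congruence that collapses t and i but neither [a_l, i] nor
[a_r, i]: two elements are related if their tops lie below the same members of a suitable set of
barriers.

Finally, let δ be join-irreducible and collapse [t, i] but neither [a_l, i] nor [a_r, i].
Restricting δ to pairs that are both low or both not low gives a congruence R, and δ = R ⊔ γ. Since
R does not collapse [t, i], irreducibility forces δ = γ (`Fork.eq_con_of_supIrred`). -/

/-! ### Planar diagrams have order dimension at most two -/

/-- `f` describes, as a function of the height, the polygonal line that a diagram draws for a
maximal chain `C` of the interval `[a, b]`. -/
structure IsTrack {P : Type*} [PartialOrder P] (pos : P → ℝ × ℝ) (a b : P) (C : Set P)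
    (f : ℝ → ℝ) : Prop where
  continuous : Continuous f
  left_mem : a ∈ C
  right_mem : b ∈ C
  le_and_le : ∀ c ∈ C, a ≤ c ∧ c ≤ b
  total : ∀ c ∈ C, ∀ d ∈ C, c ≤ d ∨ d ≤ c
  apply_vertex : ∀ c ∈ C, f (pos c).2 = (pos c).1
  exists_edge : ∀ s, (pos a).2 ≤ s → s ≤ (pos b).2 → ∃ p ∈ C, ∃ q ∈ C, p ⋖ q ∧
    (pos p).2 ≤ s ∧ s ≤ (pos q).2 ∧ (f s, s) ∈ segment ℝ (pos p) (pos q)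

/-- `pos` is a planar diagram of `P`. -/
structure IsDiagram {P : Type*} [PartialOrder P] (pos : P → ℝ × ℝ) : Prop where
  injective : Function.Injective pos
  height_lt : ∀ a b : P, a < b → (pos a).2 < (pos b).2
  segment_inter : ∀ a b c d : P, a ⋖ b → c ⋖ d → (a, b) ≠ (c, d) →
    segment ℝ (pos a) (pos b) ∩ segment ℝ (pos c) (pos d) ⊆ pos '' (({a, b} : Set P) ∩ {c, d})

section Diagram

variable {P : Type*} [PartialOrder P] {pos : P → ℝ × ℝ}

lemma IsDiagram.height_le (hpos : IsDiagram pos) {a b : P} (h : a ≤ b) : (pos a).2 ≤ (pos b).2 := by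
  rcases h.eq_or_lt with rfl | h
  · rfl
  · exact (hpos.height_lt _ _ h).le

lemma IsTrack.of_covBy (hpos : IsDiagram pos) {a b : P} (h : a ⋖ b) : ∃ C f, IsTrack pos a b C f := by
  have hh := hpos.height_lt _ _ h.lt
  have hne : (pos b).2 - (pos a).2 ≠ 0 := by linarith
  refine ⟨{a, b}, fun s => (pos a).1 +
    (s - (pos a).2) / ((pos b).2 - (pos a).2) * ((pos b).1 - (pos a).1), ?_, ?_, ?_, ?_, ?_, ?_, ?_⟩
  · fun_prop
  · simp
  · simp
  · rintro c (rfl | rfl)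
    · exact ⟨le_rfl, h.le⟩
    · exact ⟨h.le, le_rfl⟩
  · rintro c (rfl | rfl) d (rfl | rfl)
    · exact .inl le_rfl
    · exact .inl h.le
    · exact .inr h.le
    · exact .inl le_rfl
  · rintro c (rfl | rfl)
    · simp
    · simp only [div_self hne]
      ring
  · intro s hs hs'
    refine ⟨a, by simp, b, by simp, h, hs, hs', ?_⟩
    rw [segment_eq_image]
    refine ⟨(s - (pos a).2) / ((pos b).2 - (pos a).2), ⟨?_, ?_⟩, ?_⟩
    · apply div_nonneg <;> linarith
    · rw [div_le_one] <;> linarith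
    · ext
      · simp only [Prod.fst_add, Prod.smul_fst, smul_eq_mul]
        ring
      · simp only [Prod.snd_add, Prod.smul_snd, smul_eq_mul]
        field_simp
        ring

lemma IsTrack.trans (hpos : IsDiagram pos) {a b c : P} {C D : Set P} {f g : ℝ → ℝ}
    (h : IsTrack pos a b C f) (h' : IsTrack pos b c D g) : ∃ k, IsTrack pos a c (C ∪ D) k := by
  have hb := h.apply_vertex b h.right_mem
  have hb' := h'.apply_vertex b h'.left_mem
  have key : ∀ s, (pos b).2 ≤ s → (if s ≤ (pos b).2 then f s else g s) = g s := by
    intro s hs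
    split_ifs with hs'
    · obtain rfl := le_antisymm hs hs'
      rw [hb, hb']
    · rfl
  refine ⟨fun s => if s ≤ (pos b).2 then f s else g s, ?_, ?_, ?_, ?_, ?_, ?_, ?_⟩
  · refine Continuous.if_le h.continuous h'.continuous continuous_id continuous_const ?_
    rintro s rfl
    rw [hb, hb']
  · exact .inl h.left_mem
  · exact .inr h'.right_mem
  · rintro d (hd | hd)
    · exact ⟨(h.le_and_le d hd).1, (h.le_and_le d hd).2.trans (h'.le_and_le _ h'.left_mem).2⟩
    · exact ⟨(h.le_and_le _ h.right_mem).1.trans (h'.le_and_le d hd).1, (h'.le_and_le d hd).2⟩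
  · rintro d (hd | hd) e (he | he)
    · exact h.total d hd e he
    · exact .inl ((h.le_and_le d hd).2.trans (h'.le_and_le e he).1)
    · exact .inr ((h.le_and_le e he).2.trans (h'.le_and_le d hd).1)
    · exact h'.total d hd e he
  · rintro d (hd | hd)
    · simp only [if_pos (hpos.height_le (h.le_and_le d hd).2), h.apply_vertex d hd]
    · exact (key _ (hpos.height_le (h'.le_and_le d hd).1)).trans (h'.apply_vertex d hd)
  · intro s hs hs'
    rcases le_total s (pos b).2 with hsb | hsb
    · obtain ⟨p, hp, q, hq, hpq⟩ := h.exists_edge s hs hsb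
      exact ⟨p, .inl hp, q, .inl hq, by simpa only [if_pos hsb] using hpq⟩
    · obtain ⟨p, hp, q, hq, hpq⟩ := h'.exists_edge s hsb hs'
      exact ⟨p, .inr hp, q, .inr hq, by simpa only [key s hsb] using hpq⟩

lemma IsTrack.exists_of_lt [Finite P] (hpos : IsDiagram pos) {a b : P} (h : a < b) :
    ∃ C f, IsTrack pos a b C f := by
  classical
  have := Fintype.ofFinite P
  have : LocallyFiniteOrder P := Fintype.toLocallyFiniteOrder
  induction transGen_covBy_of_lt h with
  | single h' => exact IsTrack.of_covBy hpos h'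
  | @tail c d hc hcd ih =>
    obtain ⟨C, f, hf⟩ := ih (lt_iff_transGen_covBy.2 hc)
    obtain ⟨D, g, hg⟩ := IsTrack.of_covBy hpos hcd
    obtain ⟨k, hk⟩ := IsTrack.trans hpos hf hg
    exact ⟨_, k, hk⟩

lemma IsTrack.exists_through [Finite P] (hpos : IsDiagram pos) {a u v b : P} (hu : a < u)
    (huv : u ≤ v) (hv : v < b) : ∃ C f, IsTrack pos a b C f ∧ u ∈ C ∧ v ∈ C := by
  obtain ⟨C, f, hf⟩ := IsTrack.exists_of_lt hpos hu
  obtain ⟨D, g, hg⟩ := IsTrack.exists_of_lt hpos hv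
  rcases huv.eq_or_lt with rfl | huv
  · obtain ⟨k, hk⟩ := IsTrack.trans hpos hf hg
    exact ⟨_, k, hk, .inl hf.right_mem, .inl hf.right_mem⟩
  · obtain ⟨E, e, he⟩ := IsTrack.exists_of_lt hpos huv
    obtain ⟨k, hk⟩ := IsTrack.trans hpos hf he
    obtain ⟨l, hl⟩ := IsTrack.trans hpos hk hg
    exact ⟨_, l, hl, .inl (.inl hf.right_mem), .inl (.inr he.right_mem)⟩

/-- Tracks through incomparable elements do not meet between the heights of these elements. -/
lemma IsTrack.apply_ne (hpos : IsDiagram pos) {a b u v : P} {C D : Set P} {f g : ℝ → ℝ}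
    (hf : IsTrack pos a b C f) (hg : IsTrack pos a b D g) (hu : u ∈ C) (hv : v ∈ D)
    (huv : ¬ u ≤ v) (hvu : ¬ v ≤ u) {s : ℝ} (hus : (pos u).2 ≤ s) (hsv : s ≤ (pos v).2) :
    f s ≠ g s := by
  intro hfg
  have has := (hpos.height_le (hf.le_and_le u hu).1).trans hus
  have hsb := hsv.trans (hpos.height_le (hg.le_and_le v hv).2)
  obtain ⟨p, hp, q, hq, hpq, hps, hsq, hmem⟩ := hf.exists_edge s has hsb
  obtain ⟨p', hp', q', hq', hpq', hps', hsq', hmem'⟩ := hg.exists_edge s has hsb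
  have up : ∀ z ∈ C, s ≤ (pos z).2 → u ≤ z := by
    intro z hz hsz
    rcases hf.total u hu z hz with h | h
    · exact h
    · rcases h.eq_or_lt with rfl | h
      · exact le_rfl
      · linarith [hpos.height_lt _ _ h]
  have down : ∀ z ∈ D, (pos z).2 ≤ s → z ≤ v := by
    intro z hz hsz
    rcases hg.total z hz v hv with h | h
    · exact h
    · rcases h.eq_or_lt with rfl | h
      · exact le_rfl
      · linarith [hpos.height_lt _ _ h]
  -- If the tracks share the edge p ⋖ q, then u ≤ p ≤ v, or u = q lies on the chain of v. Distinct
  -- edges meet only in a common vertex, which is then above u and below v.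
  by_cases he : (p, q) = (p', q')
  · obtain ⟨rfl, rfl⟩ := Prod.mk.inj he
    have huq := up q hq hsq
    rcases hf.total u hu p hp with h | h
    · exact huv (h.trans (down p hp' hps))
    · rcases h.eq_or_lt with rfl | h
      · exact huv (down p hp' hps)
      · rcases huq.eq_or_lt with rfl | huq
        · rcases hg.total u hq' v hv with h | h
          · exact huv h
          · exact hvu h
        · exact hpq.2 h huq
  · rw [← hfg] at hmem'
    obtain ⟨z, ⟨hz, hz'⟩, hzs⟩ := hpos.segment_inter p q p' q' hpq hpq' he ⟨hmem, hmem'⟩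
    have hh : (pos z).2 = s := by rw [hzs]
    have hzC : z ∈ C := by
      rcases hz with rfl | rfl <;> assumption
    have hzD : z ∈ D := by
      rcases hz' with rfl | rfl <;> assumption
    exact huv ((up z hzC hh.ge).trans (down z hzD hh.le))

lemma IsTrack.apply_ne_of_mem_uIcc (hpos : IsDiagram pos) {a b u v : P} {C D : Set P}
    {f g : ℝ → ℝ} (hf : IsTrack pos a b C f) (hg : IsTrack pos a b D g) (hu : u ∈ C) (hv : v ∈ D)
    (huv : ¬ u ≤ v) (hvu : ¬ v ≤ u) {s : ℝ} (hs : s ∈ Set.uIcc (pos u).2 (pos v).2) :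
    f s ≠ g s := by
  rcases Set.mem_uIcc.1 hs with h | h
  · exact IsTrack.apply_ne hpos hf hg hu hv huv hvu h.1 h.2
  · exact (IsTrack.apply_ne hpos hg hf hv hu hvu huv h.1 h.2).symm

/-- Intermediate value theorem: the tracks do not meet between the two heights. -/
lemma IsTrack.lt_of_lt (hpos : IsDiagram pos) {a b u v : P} {C D : Set P}
    {f g : ℝ → ℝ} (hf : IsTrack pos a b C f) (hg : IsTrack pos a b D g) (hu : u ∈ C) (hv : v ∈ D)
    (huv : ¬ u ≤ v) (hvu : ¬ v ≤ u) {s s' : ℝ} (hs : s ∈ Set.uIcc (pos u).2 (pos v).2)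
    (hs' : s' ∈ Set.uIcc (pos u).2 (pos v).2) (h : f s < g s) : f s' < g s' := by
  by_contra hlt
  have hc : ContinuousOn (fun r => g r - f r) (Set.uIcc s s') :=
    (hg.continuous.sub hf.continuous).continuousOn
  have h0 : (0 : ℝ) ∈ Set.uIcc (g s - f s) (g s' - f s') :=
    Set.mem_uIcc.2 (.inr ⟨by linarith, by linarith⟩)
  obtain ⟨r, hr, hr0⟩ := intermediate_value_uIcc hc h0
  exact IsTrack.apply_ne_of_mem_uIcc hpos hf hg hu hv huv hvu (Set.uIcc_subset_uIcc hs hs' hr)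
    (by simp only at hr0; linarith)

/-- `u` and `v` are incomparable, and `u` is drawn to the left of `v`. -/
def LeftOf (pos : P → ℝ × ℝ) (a b u v : P) : Prop :=
  ¬ u ≤ v ∧ ¬ v ≤ u ∧ ∀ C f D g, IsTrack pos a b C f → IsTrack pos a b D g → u ∈ C → v ∈ D →
    ∀ s ∈ Set.uIcc (pos u).2 (pos v).2, f s < g s

/-- One pair of tracks and one height decide: all tracks through u agree at the height of u, all
tracks through v agree at the height of v, and no change of sides occurs in between. -/
lemma leftOf_of_lt (hpos : IsDiagram pos) {a b u v : P} (huv : ¬ u ≤ v) (hvu : ¬ v ≤ u)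
    {C D : Set P} {f g : ℝ → ℝ} (hf : IsTrack pos a b C f) (hg : IsTrack pos a b D g)
    (hu : u ∈ C) (hv : v ∈ D) {s : ℝ} (hs : s ∈ Set.uIcc (pos u).2 (pos v).2) (h : f s < g s) :
    LeftOf pos a b u v := by
  refine ⟨huv, hvu, fun C' f' D' g' hf' hg' hu' hv' s' hs' => ?_⟩
  have h1 : f' (pos u).2 < g (pos u).2 := by
    rw [hf'.apply_vertex u hu', ← hf.apply_vertex u hu]
    exact IsTrack.lt_of_lt hpos hf hg hu hv huv hvu hs Set.left_mem_uIcc h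
  have h2 := IsTrack.lt_of_lt hpos hf' hg hu' hv huv hvu Set.left_mem_uIcc Set.right_mem_uIcc h1
  rw [hg.apply_vertex v hv, ← hg'.apply_vertex v hv'] at h2
  exact IsTrack.lt_of_lt hpos hf' hg' hu' hv' huv hvu Set.right_mem_uIcc hs' h2

end Diagram

/-! ### The left-of relation and its two linear extensions -/

section Dimension

variable {P : Type*} [PartialOrder P] [Finite P] {pos : P → ℝ × ℝ} {a b u v w : P}

lemma exists_track_of_incomparable (hpos : IsDiagram pos) (ha : ∀ x, a ≤ x) (hb : ∀ x, x ≤ b)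
    (huv : ¬ u ≤ v) (hvu : ¬ v ≤ u) : ∃ C f, IsTrack pos a b C f ∧ u ∈ C := by
  obtain ⟨C, f, hf, hu, -⟩ := IsTrack.exists_through hpos (u := u) (v := u)
    ((ha u).lt_of_ne (by rintro rfl; exact huv (ha v))) le_rfl
    ((hb u).lt_of_ne (by rintro rfl; exact hvu (hb v)))
  exact ⟨C, f, hf, hu⟩

lemma leftOf_or_leftOf (hpos : IsDiagram pos) (ha : ∀ x, a ≤ x) (hb : ∀ x, x ≤ b)
    (huv : ¬ u ≤ v) (hvu : ¬ v ≤ u) : LeftOf pos a b u v ∨ LeftOf pos a b v u := by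
  obtain ⟨C, f, hf, hu⟩ := exists_track_of_incomparable hpos ha hb huv hvu
  obtain ⟨D, g, hg, hv⟩ := exists_track_of_incomparable hpos ha hb hvu huv
  have hs : (pos u).2 ∈ Set.uIcc (pos u).2 (pos v).2 := Set.left_mem_uIcc
  rcases lt_or_gt_of_ne (IsTrack.apply_ne_of_mem_uIcc hpos hf hg hu hv huv hvu hs) with h | h
  · exact .inl (leftOf_of_lt hpos huv hvu hf hg hu hv hs h)
  · exact .inr (leftOf_of_lt hpos hvu huv hg hf hv hu Set.right_mem_uIcc h)

lemma LeftOf.not_leftOf (hpos : IsDiagram pos) (ha : ∀ x, a ≤ x) (hb : ∀ x, x ≤ b)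
    (h : LeftOf pos a b u v) : ¬ LeftOf pos a b v u := by
  intro h'
  obtain ⟨C, f, hf, hu⟩ := exists_track_of_incomparable hpos ha hb h.1 h.2.1
  obtain ⟨D, g, hg, hv⟩ := exists_track_of_incomparable hpos ha hb h.2.1 h.1
  have h1 := h.2.2 C f D g hf hg hu hv _ Set.left_mem_uIcc
  have h2 := h'.2.2 D g C f hg hf hv hu _ Set.right_mem_uIcc
  exact lt_asymm h1 h2

lemma exists_track_pair (hpos : IsDiagram pos) (ha : ∀ x, a ≤ x) (hb : ∀ x, x ≤ b)
    (huv : ¬ u ≤ v) (hvu : ¬ v ≤ u) (huw : ¬ u ≤ w) (hwu : ¬ w ≤ u) (hvw : v ≤ w ∨ w ≤ v) :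
    ∃ C f, IsTrack pos a b C f ∧ v ∈ C ∧ w ∈ C := by
  have hav : a < v := (ha v).lt_of_ne (by rintro rfl; exact hvu (ha u))
  have hvb : v < b := (hb v).lt_of_ne (by rintro rfl; exact huv (hb u))
  have haw : a < w := (ha w).lt_of_ne (by rintro rfl; exact hwu (ha u))
  have hwb : w < b := (hb w).lt_of_ne (by rintro rfl; exact huw (hb u))
  rcases hvw with h | h
  · exact IsTrack.exists_through hpos hav h hwb
  · obtain ⟨C, f, hf, h1, h2⟩ := IsTrack.exists_through hpos haw h hvb
    exact ⟨C, f, hf, h2, h1⟩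

/-- A single track passes through both v and w, and at the height of u it runs to the right of u. -/
lemma LeftOf.of_comparable_right (hpos : IsDiagram pos) (ha : ∀ x, a ≤ x) (hb : ∀ x, x ≤ b)
    (h : LeftOf pos a b u v) (hvw : v ≤ w ∨ w ≤ v) (huw : ¬ u ≤ w) (hwu : ¬ w ≤ u) :
    LeftOf pos a b u w := by
  obtain ⟨C, f, hf, hu⟩ := exists_track_of_incomparable hpos ha hb h.1 h.2.1
  obtain ⟨D, g, hg, hv, hw⟩ := exists_track_pair hpos ha hb h.1 h.2.1 huw hwu hvw
  exact leftOf_of_lt hpos huw hwu hf hg hu hw Set.left_mem_uIcc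
    (h.2.2 C f D g hf hg hu hv _ Set.left_mem_uIcc)

lemma LeftOf.of_comparable_left (hpos : IsDiagram pos) (ha : ∀ x, a ≤ x) (hb : ∀ x, x ≤ b)
    (h : LeftOf pos a b v u) (hvw : v ≤ w ∨ w ≤ v) (huw : ¬ u ≤ w) (hwu : ¬ w ≤ u) :
    LeftOf pos a b w u := by
  rcases leftOf_or_leftOf hpos ha hb hwu huw with h' | h'
  · exact h'
  · exact absurd h (LeftOf.not_leftOf hpos ha hb
      (h'.of_comparable_right hpos ha hb hvw.symm h.2.1 h.1))

lemma LeftOf.not_cycle (hpos : IsDiagram pos) (ha : ∀ x, a ≤ x) (hb : ∀ x, x ≤ b)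
    (h₁ : LeftOf pos a b u v) (h₂ : LeftOf pos a b v w) : ¬ LeftOf pos a b w u := by
  intro h₃
  obtain ⟨C, f, hf, hu⟩ := exists_track_of_incomparable hpos ha hb h₁.1 h₁.2.1
  obtain ⟨D, g, hg, hv⟩ := exists_track_of_incomparable hpos ha hb h₂.1 h₂.2.1
  obtain ⟨E, e, he, hw⟩ := exists_track_of_incomparable hpos ha hb h₃.1 h₃.2.1
  have k₁ := h₁.2.2 C f D g hf hg hu hv
  have k₂ := h₂.2.2 D g E e hg he hv hw
  have k₃ := h₃.2.2 E e C f he hf hw hu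
  -- The three height intervals share the median of the three heights; there the tracks would
  -- satisfy f < g < e < f.
  have key : ∀ s, s ∈ Set.uIcc (pos u).2 (pos v).2 → s ∈ Set.uIcc (pos v).2 (pos w).2 →
      s ∈ Set.uIcc (pos w).2 (pos u).2 → False := fun s h1 h2 h3 => by
    linarith [k₁ s h1, k₂ s h2, k₃ s h3]
  simp only [Set.mem_uIcc] at key
  rcases le_total (pos u).2 (pos v).2 with h1 | h1 <;>
  rcases le_total (pos v).2 (pos w).2 with h2 | h2 <;>
  rcases le_total (pos u).2 (pos w).2 with h3 | h3
  · exact key (pos v).2 (by simp [h1]) (by simp [h2]) (by simp [h1, h2])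
  · exact key (pos v).2 (by simp [h1]) (by simp [h2]) (.inl ⟨by linarith, by linarith⟩)
  · exact key (pos w).2 (by simp [h2, h3]) (by simp [h2]) (by simp [h3])
  · exact key (pos u).2 (by simp [h1]) (by simp [h1, h3]) (by simp [h3])
  · exact key (pos u).2 (by simp [h1]) (by simp [h1, h3]) (by simp [h3])
  · exact key (pos w).2 (by simp [h2, h3]) (by simp [h2]) (by simp [h3])
  · exact key (pos v).2 (by simp [h1]) (by simp [h2]) (.inr ⟨by linarith, by linarith⟩)
  · exact key (pos v).2 (by simp [h1]) (by simp [h2]) (by simp [h1, h2])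

/-- If u and w were comparable, w would inherit from u the position to the left of v. -/
lemma LeftOf.trans (hpos : IsDiagram pos) (ha : ∀ x, a ≤ x) (hb : ∀ x, x ≤ b)
    (h₁ : LeftOf pos a b u v) (h₂ : LeftOf pos a b v w) : LeftOf pos a b u w := by
  by_cases hc : u ≤ w ∨ w ≤ u
  · exact absurd h₂ (LeftOf.not_leftOf hpos ha hb
      (h₁.of_comparable_left hpos ha hb hc h₂.1 h₂.2.1))
  · push Not at hc
    exact (leftOf_or_leftOf hpos ha hb hc.1 hc.2).resolve_right (h₁.not_cycle hpos ha hb h₂)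

end Dimension

/-- A planar ordered set with least and greatest elements has order dimension at most two. -/
theorem IsPlanar.exists_realizer {P : Type*} [PartialOrder P] (hP : IsPlanar P) {a b : P}
    (ha : ∀ x, a ≤ x) (hb : ∀ x, x ≤ b) :
    ∃ r s : P → P → Prop, (∀ u v w, r u v → r v w → r u w) ∧ (∀ u v w, s u v → s v w → s u w) ∧
      (∀ u v, r u v ∨ r v u) ∧ (∀ u v, s u v ∨ s v u) ∧ ∀ u v, u ≤ v ↔ r u v ∧ s u v := by
  obtain ⟨hfin, pos, h1, h2, h3⟩ := hP
  have hpos : IsDiagram pos := ⟨h1, h2, h3⟩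
  have tot : ∀ u v : P, (u ≤ v ∨ LeftOf pos a b u v) ∨ (v ≤ u ∨ LeftOf pos a b v u) := by
    intro u v
    by_cases h : u ≤ v
    · exact .inl (.inl h)
    by_cases h' : v ≤ u
    · exact .inr (.inl h')
    rcases leftOf_or_leftOf hpos ha hb h h' with k | k
    · exact .inl (.inr k)
    · exact .inr (.inr k)
  -- The order is extended once by "left of" and once by "right of".
  refine ⟨fun u v => u ≤ v ∨ LeftOf pos a b u v, fun u v => u ≤ v ∨ LeftOf pos a b v u,
    ?_, ?_, tot, ?_, ?_⟩
  · rintro u v w (huv | huv) (hvw | hvw)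
    · exact .inl (huv.trans hvw)
    · by_cases h : u ≤ w
      · exact .inl h
      · exact .inr (hvw.of_comparable_left hpos ha hb (.inr huv)
          (fun h' => hvw.2.1 (h'.trans huv)) h)
    · by_cases h : u ≤ w
      · exact .inl h
      · exact .inr (huv.of_comparable_right hpos ha hb (.inl hvw) h
          (fun h' => huv.2.1 (hvw.trans h')))
    · exact .inr (huv.trans hpos ha hb hvw)
  · rintro u v w (huv | huv) (hvw | hvw)
    · exact .inl (huv.trans hvw)
    · by_cases h : u ≤ w
      · exact .inl h
      · exact .inr (hvw.of_comparable_right hpos ha hb (.inr huv)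
          (fun h' => hvw.1 (h'.trans huv)) h)
    · by_cases h : u ≤ w
      · exact .inl h
      · exact .inr (huv.of_comparable_left hpos ha hb (.inl hvw) h
          (fun h' => huv.1 (hvw.trans h')))
    · exact .inr (hvw.trans hpos ha hb huv)
  · intro u v
    rcases tot u v with (h | h) | (h | h)
    · exact .inl (.inl h)
    · exact .inr (.inr h)
    · exact .inr (.inl h)
    · exact .inl (.inr h)
  · intro u v
    refine ⟨fun h => ⟨.inl h, .inl h⟩, ?_⟩
    rintro ⟨h | h, h' | h'⟩
    · exact h
    · exact h
    · exact h'
    · exact absurd h' (h.not_leftOf hpos ha hb)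

/-! ### Slim, planar, semimodular lattices: local structure -/

section Slim

variable {L : Type*} [Lattice L]

/-- Among three pairwise incomparable elements of a planar lattice, one lies between the meet and
the join of the other two. -/
theorem IsPlanar.exists_middle (hP : IsPlanar L) {a b c : L} (hab : ¬ a ≤ b) (hba : ¬ b ≤ a)
    (hac : ¬ a ≤ c) (hca : ¬ c ≤ a) (hbc : ¬ b ≤ c) (hcb : ¬ c ≤ b) :
    (a ⊓ b ≤ c ∧ c ≤ a ⊔ b) ∨ (a ⊓ c ≤ b ∧ b ≤ a ⊔ c) ∨ (b ⊓ c ≤ a ∧ a ≤ b ⊔ c) := by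
  have hfin := hP.1
  obtain ⟨m, h0⟩ : ∃ x : L, ∀ y, x ≤ y := by
    obtain ⟨x, hx⟩ := (Set.toFinite (Set.univ : Set L)).exists_minimal ⟨a, trivial⟩
    exact ⟨x, fun y => (hx.2 trivial (inf_le_left : x ⊓ y ≤ x)).trans inf_le_right⟩
  obtain ⟨n, h1⟩ : ∃ x : L, ∀ y, y ≤ x := by
    obtain ⟨x, hx⟩ := (Set.toFinite (Set.univ : Set L)).exists_maximal ⟨a, trivial⟩
    exact ⟨x, fun y => le_sup_right.trans (hx.2 trivial (le_sup_left : x ≤ x ⊔ y))⟩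
  obtain ⟨r, s, hr, hs, hr', hs', hle⟩ := hP.exists_realizer h0 h1
  -- An element between p and t for `r` is also between them, in reverse, for `s`; the bounds then
  -- hold in both relations.
  have key : ∀ p q t : L, ¬ p ≤ q → ¬ q ≤ t → r p q → r q t → p ⊓ t ≤ q ∧ q ≤ p ⊔ t := by
    intro p q t hpq hqt h1 h2
    have h3 : s q p := (hs' q p).resolve_right fun h => hpq ((hle _ _).2 ⟨h1, h⟩)
    have h4 : s t q := (hs' t q).resolve_right fun h => hqt ((hle _ _).2 ⟨h2, h⟩)
    have e1 := (hle _ _).1 (inf_le_left : p ⊓ t ≤ p)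
    have e2 := (hle _ _).1 (inf_le_right : p ⊓ t ≤ t)
    have e3 := (hle _ _).1 (le_sup_left : p ≤ p ⊔ t)
    have e4 := (hle _ _).1 (le_sup_right : t ≤ p ⊔ t)
    exact ⟨(hle _ _).2 ⟨hr _ _ _ e1.1 h1, hs _ _ _ e2.2 h4⟩,
      (hle _ _).2 ⟨hr _ _ _ h2 e4.1, hs _ _ _ h3 e3.2⟩⟩
  rcases hr' a b with h | h <;> rcases hr' b c with k | k <;> rcases hr' a c with l | l
  · exact .inr (.inl (key a b c hab hbc h k))
  · exact .inr (.inl (key a b c hab hbc h k))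
  · have := key a c b hac hcb l k
    exact .inl this
  · have := key c a b hca hab l h
    exact .inr (.inr (by rwa [inf_comm, sup_comm]))
  · have := key b a c hba hac h l
    exact .inr (.inr this)
  · have := key b c a hbc hca k l
    exact .inl (by rwa [inf_comm, sup_comm])
  · have := key c b a hcb hba k h
    exact .inr (.inl (by rwa [inf_comm, sup_comm]))
  · have := key c b a hcb hba k h
    exact .inr (.inl (by rwa [inf_comm, sup_comm]))

lemma CovBy.not_le_of_covBy_of_ne {o a b : L} (ha : o ⋖ a) (hb : o ⋖ b) (h : a ≠ b) : ¬ a ≤ b :=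
  fun hab => h (hab.eq_of_not_lt fun hlt => hb.2 ha.lt hlt)

lemma CovBy.inf_eq_of_not_le {o a b : L} (ha : o ⋖ a) (hb : o ≤ b) (h : ¬ a ≤ b) : a ⊓ b = o := by
  rcases (le_inf ha.le hb).eq_or_lt with h' | h'
  · exact h'.symm
  · rcases ha.eq_or_eq h'.le inf_le_left with h'' | h''
    · exact h''
    · exact absurd (inf_eq_left.1 h'') h

lemma CovBy.covBy_sup_of_not_le [IsUpperModularLattice L] {o a b : L} (ha : o ⋖ a) (hb : o ≤ b)
    (h : ¬ a ≤ b) : b ⋖ a ⊔ b := by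
  have h' := CovBy.inf_eq_of_not_le ha hb h
  exact covBy_sup_of_inf_covBy_left (by rwa [h'])

namespace IsSPS

/-- By semimodularity, a, b, c would be the middle elements of an M₃ with bottom o and top a ⊔ b. -/
lemma not_between (hL : IsSPS L) {o a b c : L} (ha : o ⋖ a) (hb : o ⋖ b) (hc : o ⋖ c)
    (hab : a ≠ b) (hac : a ≠ c) (hbc : b ≠ c) : ¬ c ≤ a ⊔ b := by
  intro h
  have := hL.semimodular
  have nab := CovBy.not_le_of_covBy_of_ne ha hb hab
  have nba := CovBy.not_le_of_covBy_of_ne hb ha hab.symm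
  have nac := CovBy.not_le_of_covBy_of_ne ha hc hac
  have nbc := CovBy.not_le_of_covBy_of_ne hb hc hbc
  have nca := CovBy.not_le_of_covBy_of_ne hc ha hac.symm
  have ncb := CovBy.not_le_of_covBy_of_ne hc hb hbc.symm
  have h1 : b ⋖ a ⊔ b := CovBy.covBy_sup_of_not_le ha hb.le nab
  have h2 : a ⋖ a ⊔ b := sup_comm b a ▸ CovBy.covBy_sup_of_not_le hb ha.le nba
  have e1 : a ⊔ c = a ⊔ b := (h2.eq_or_eq le_sup_left (sup_le le_sup_left h)).resolve_left
    fun e => nca (sup_eq_left.1 e)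
  have e2 : b ⊔ c = a ⊔ b := (h1.eq_or_eq le_sup_left (sup_le le_sup_right h)).resolve_left
    fun e => ncb (sup_eq_left.1 e)
  exact hL.slim ⟨o, a, b, c, a ⊔ b, hab, hac, hbc, CovBy.inf_eq_of_not_le ha hb.le nab,
    CovBy.inf_eq_of_not_le ha hc.le nac, CovBy.inf_eq_of_not_le hb hc.le nbc, rfl, e1, e2⟩

/-- An element of an SPS lattice has at most two covers. -/
theorem eq_or_eq_or_eq_of_covBy (hL : IsSPS L) {o a b c : L} (ha : o ⋖ a) (hb : o ⋖ b)
    (hc : o ⋖ c) : a = b ∨ a = c ∨ b = c := by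
  by_contra! hne
  obtain ⟨hab, hac, hbc⟩ := hne
  rcases hL.planar.exists_middle
    (CovBy.not_le_of_covBy_of_ne ha hb hab) (CovBy.not_le_of_covBy_of_ne hb ha hab.symm)
    (CovBy.not_le_of_covBy_of_ne ha hc hac) (CovBy.not_le_of_covBy_of_ne hc ha hac.symm)
    (CovBy.not_le_of_covBy_of_ne hb hc hbc) (CovBy.not_le_of_covBy_of_ne hc hb hbc.symm)
    with h | h | h
  · exact hL.not_between ha hb hc hab hac hbc h.2
  · exact hL.not_between ha hc hb hac hab hbc.symm h.2
  · exact hL.not_between hb hc ha hbc hab.symm hac.symm h.2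

lemma exists_covBy_le_of_lt (hL : IsSPS L) {a b : L} (h : a < b) : ∃ c, a ⋖ c ∧ c ≤ b := by
  have := hL.planar.1
  exact _root_.exists_covBy_le_of_lt h

/-- If `c` covers `m`, the elements above `m` that are not above `c` form a chain. -/
theorem le_or_le_of_not_le (hL : IsSPS L) {m c a b : L} (hc : m ⋖ c) (hma : m ≤ a) (hmb : m ≤ b)
    (hca : ¬ c ≤ a) (hcb : ¬ c ≤ b) : a ≤ b ∨ b ≤ a := by
  have := hL.semimodular
  by_contra! h
  -- Otherwise a ⊓ b has three distinct covers: one below a, one below b, and c ⊔ (a ⊓ b).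
  obtain ⟨a', ha', haa⟩ := hL.exists_covBy_le_of_lt (inf_lt_left.2 h.1)
  obtain ⟨b', hb', hbb⟩ := hL.exists_covBy_le_of_lt (inf_lt_right.2 h.2)
  have hd : a ⊓ b ⋖ c ⊔ a ⊓ b := CovBy.covBy_sup_of_not_le hc (le_inf hma hmb)
    fun h' => hca (h'.trans inf_le_left)
  rcases hL.eq_or_eq_or_eq_of_covBy ha' hb' hd with e | e | e
  · exact ha'.lt.not_ge (le_inf haa (e ▸ hbb))
  · exact hca ((le_sup_left.trans e.ge).trans haa)
  · exact hcb ((le_sup_left.trans e.ge).trans hbb)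

/-- Meet-semidistributivity, in the form needed here. -/
theorem le_or_le_of_inf_eq (hL : IsSPS L) {a b c : L} (h : c ⊓ a = c ⊓ b) (hca : ¬ c ≤ a) :
    a ≤ b ∨ b ≤ a := by
  -- A cover of c ⊓ a inside c is below neither a nor b.
  obtain ⟨d, hd, hdc⟩ := hL.exists_covBy_le_of_lt (inf_lt_left.2 hca)
  refine hL.le_or_le_of_not_le hd inf_le_right (h.trans_le inf_le_right) ?_ ?_
  · exact fun h' => hd.lt.not_ge (le_inf hdc h')
  · exact fun h' => hd.lt.not_ge (h.ge.trans' (le_inf hdc h'))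

/-- In the pairwise incomparable case one of the three is in the middle. If it is b, then a ⊓ b = a
⊓ c and semidistributivity makes b and c comparable; the case of a is symmetric. So it is c. -/
theorem le_or_le_or_le_sup (hL : IsSPS L) {a b c : L} (h : a ⊓ b ≤ c) :
    a ≤ c ∨ b ≤ c ∨ c ≤ a ⊔ b := by
  by_contra! hn
  obtain ⟨hac, hbc, hcab⟩ := hn
  have hca : ¬ c ≤ a := fun h' => hcab (h'.trans le_sup_left)
  have hcb : ¬ c ≤ b := fun h' => hcab (h'.trans le_sup_right)
  have hab : ¬ a ≤ b := fun h' => hac ((le_inf le_rfl h').trans h)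
  have hba : ¬ b ≤ a := fun h' => hbc ((le_inf h' le_rfl).trans h)
  rcases hL.planar.exists_middle hab hba hac hca hbc hcb with k | k | k
  · exact hcab k.2
  · have e : a ⊓ b = a ⊓ c := le_antisymm (le_inf inf_le_left h) (le_inf inf_le_left k.1)
    rcases hL.le_or_le_of_inf_eq e hab with h' | h'
    exacts [hbc h', hcb h']
  · have e : b ⊓ a = b ⊓ c :=
      le_antisymm (le_inf inf_le_left (inf_comm a b ▸ h)) (le_inf inf_le_left k.1)
    rcases hL.le_or_le_of_inf_eq e hba with h' | h'
    exacts [hac h', hca h']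

end IsSPS

/-! ### The trace of a fork -/

namespace ForkTrace

variable {o a x y : L}

lemma covBy (h : ForkTrace o a y x) (hoa : o ⋖ a) : y ⋖ x := by
  cases h with
  | base => exact hoa
  | step h hT => exact hT.1

lemma left_le (h : ForkTrace o a y x) : y ≤ o := by
  induction h with
  | base => exact le_rfl
  | step h hT ih => exact inf_le_right.trans ih

lemma right_le (h : ForkTrace o a y x) : x ≤ a := by
  induction h with
  | base => exact le_rfl
  | step h hT ih => exact hT.2.2.1.le.trans ih

/-- Each step is a perspectivity, so [y, x] is perspective up to [o, a]. This keeps x out of the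
ideal of o and lets x determine y. -/
lemma le_sup (h : ForkTrace o a y x) : a ≤ o ⊔ x := by
  induction h with
  | base => exact le_sup_right
  | @step y x x' h hT ih =>
    obtain ⟨h1, h2, h3, h4, h5⟩ := hT
    have hx : x ≤ y ⊔ x' := by
      rcases h4.eq_or_eq (le_sup_left : y ≤ y ⊔ x') (sup_le h4.le h3.le) with e | e
      · exact absurd (sup_eq_left.1 e) (CovBy.not_le_of_covBy_of_ne h1 h2 h5)
      · exact e.ge
    exact ih.trans (sup_le le_sup_left (hx.trans (sup_le_sup_right h.left_le _)))

lemma not_le (h : ForkTrace o a y x) (hoa : o ⋖ a) : ¬ x ≤ o :=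
  fun hx => hoa.lt.not_ge (h.le_sup.trans (sup_le le_rfl hx))

lemma inf_eq (h : ForkTrace o a y x) (hoa : o ⋖ a) : x ⊓ o = y :=
  CovBy.inf_eq_of_not_le (h.covBy hoa) h.left_le (h.not_le hoa)

lemma left_eq {y' : L} (h : ForkTrace o a y x) (h' : ForkTrace o a y' x) (hoa : o ⋖ a) :
    y = y' :=
  (h.inf_eq hoa).symm.trans (h'.inf_eq hoa)

/-- From the trace at `(y, x)`, the joins with elements of `[y, o]` stay in the trace; every
reflexive and transitive relation that contains the trace steps contains the resulting pairs. -/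
lemma sup_and (hL : IsSPS L) (hoa : o ⋖ a)
    (Q : (y x y' x' : L) → ForkTrace o a y x → ForkTrace o a y' x' → Prop)
    (hrefl : ∀ y x h, Q y x y x h h)
    (hstep : ∀ y x x' y'' x'' h h'' hT, Q y x y'' x'' h h'' →
      Q (x' ⊓ y) x' y'' x'' (h.step hT) h'')
    (h : ForkTrace o a y x) {b : L} (hyb : y ≤ b) (hbo : b ≤ o) :
    ∃ h' : ForkTrace o a b (b ⊔ x), Q y x b (b ⊔ x) h h' := by
  induction h with
  | base =>
    obtain rfl := le_antisymm hyb hbo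
    have e : o ⊔ a = a := sup_eq_right.2 hoa.le
    rw [e]
    exact ⟨.base, hrefl _ _ _⟩
  | @step y x x' h hT ih =>
    have hx := (h.step hT).not_le hoa
    rcases hyb.eq_or_lt with rfl | hlt
    · have e : x' ⊓ y ⊔ x' = x' := sup_eq_right.2 hT.1.le
      rw [e]
      exact ⟨h.step hT, hrefl _ _ _⟩
    -- The only covers of x' ⊓ y are x' and y, and x' is not below o. So b passes through y, and the
    -- induction applies.
    · obtain ⟨c, hc, hcb⟩ := hL.exists_covBy_le_of_lt hlt
      have hyb' : y ≤ b := by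
        rcases hL.eq_or_eq_or_eq_of_covBy hT.1 hT.2.1 hc with e | e | e
        · exact absurd e hT.2.2.2.2
        · exact absurd (e ▸ hcb.trans hbo) hx
        · exact e ▸ hcb
      obtain ⟨h', hQ⟩ := ih hyb'
      have e : b ⊔ x' = b ⊔ x := by
        apply le_antisymm (sup_le_sup_left hT.2.2.1.le _)
        refine sup_le le_sup_left ?_
        have hT' := hT
        obtain ⟨h1, h2, h3, h4, h5⟩ := hT'
        rcases h4.eq_or_eq (le_sup_left : y ≤ y ⊔ x') (sup_le h4.le h3.le) with e | e
        · exact absurd (sup_eq_left.1 e) (CovBy.not_le_of_covBy_of_ne h1 h2 h5)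
        · exact e.ge.trans (sup_le_sup_right hyb' _)
      rw [e]
      exact ⟨h', hstep _ _ _ _ _ h h' hT hQ⟩

lemma sup (hL : IsSPS L) (hoa : o ⋖ a) (h : ForkTrace o a y x) {b : L} (hyb : y ≤ b)
    (hbo : b ≤ o) : ForkTrace o a b (b ⊔ x) :=
  (h.sup_and hL hoa (fun _ _ _ _ _ _ => True) (fun _ _ _ => trivial)
    (fun _ _ _ _ _ _ _ _ _ => trivial) hyb hbo).1

lemma exists_covBy_of_lt (h : ForkTrace o a y x) (hy : y < o) : ∃ c, y ⋖ c ∧ c ≤ o := by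
  cases h with
  | base => exact absurd hy (lt_irrefl _)
  | step h hT => exact ⟨_, hT.2.1, h.left_le⟩

/-- The two traces of a fork meet only in the bottom of the square. -/
lemma left_sup_left (hL : IsSPS L) {a' x' y' : L} (hoa : o ⋖ a) (hoa' : o ⋖ a') (haa : a ≠ a')
    (h : ForkTrace o a y x) (h' : ForkTrace o a' y' x') : y ⊔ y' = o := by
  have hle : y ⊔ y' ≤ o := sup_le h.left_le h'.left_le
  have k := h.sup hL hoa le_sup_left hle
  have k' := h'.sup hL hoa' le_sup_right hle
  by_contra hne
  obtain ⟨c, hc, hco⟩ := k.exists_covBy_of_lt (hle.lt_of_ne hne)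
  -- If y ⊔ y' < o, it would have three distinct covers: one below o, and one on each trace.
  rcases hL.eq_or_eq_or_eq_of_covBy hc (k.covBy hoa) (k'.covBy hoa') with e | e | e
  · exact k.not_le hoa (e ▸ hco)
  · exact k'.not_le hoa' (e ▸ hco)
  · have h1 : a ≤ a' := k.le_sup.trans (sup_le hoa'.le (e ▸ k'.right_le))
    exact CovBy.not_le_of_covBy_of_ne hoa hoa' haa h1

/-- Below o, the element y ⊔ y' already has a cover inside the ideal of o, so only one other cover
is left for its joins with x and x'. This makes the tops of low elements closed under joins. -/
lemma sup_sup (hL : IsSPS L) (hoa : o ⋖ a) {x' y' : L} (h : ForkTrace o a y x)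
    (h' : ForkTrace o a y' x') : ForkTrace o a (y ⊔ y') (x ⊔ x') := by
  have hle : y ⊔ y' ≤ o := sup_le h.left_le h'.left_le
  have k := h.sup hL hoa le_sup_left hle
  have k' := h'.sup hL hoa le_sup_right hle
  have e : y ⊔ y' ⊔ x = y ⊔ y' ⊔ x' := by
    rcases hle.eq_or_lt with hy | hy
    · exact le_antisymm (k.right_le.trans (k'.le_sup.trans (sup_le (hy ▸ le_sup_left) le_rfl)))
        (k'.right_le.trans (k.le_sup.trans (sup_le (hy ▸ le_sup_left) le_rfl)))
    · obtain ⟨c, hc, hco⟩ := k.exists_covBy_of_lt hy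
      rcases hL.eq_or_eq_or_eq_of_covBy hc (k.covBy hoa) (k'.covBy hoa) with e | e | e
      · exact absurd (e ▸ hco) (k.not_le hoa)
      · exact absurd (e ▸ hco) (k'.not_le hoa)
      · exact e
  have e' : x ⊔ x' = y ⊔ y' ⊔ x := by
    apply le_antisymm (sup_le le_sup_right (e ▸ le_sup_right))
    exact sup_le (sup_le_sup (h.covBy hoa).le (h'.covBy hoa).le) le_sup_left
  rwa [e']

/-- Every element below `a` but not below `o` is above an element of the trace. -/
lemma exists_le (hL : IsSPS L) (hoa : o ⋖ a) {w : L} (hwa : w ≤ a) (hwo : ¬ w ≤ o) :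
    ∃ y x, ForkTrace o a y x ∧ x ≤ w := by
  have hfin := hL.planar.1
  have := hL.semimodular
  obtain ⟨w', hw', hmin⟩ := (Set.toFinite {v | v ≤ w ∧ ¬ v ≤ o}).exists_minimal ⟨w, le_rfl, hwo⟩
  obtain ⟨x, ⟨⟨y, hyx⟩, hwx⟩, hxmin⟩ :=
    (Set.toFinite {x | (∃ y, ForkTrace o a y x) ∧ w' ≤ x}).exists_minimal
      ⟨a, ⟨o, .base⟩, hw'.1.trans hwa⟩
  rcases hwx.eq_or_lt with rfl | hlt
  · exact ⟨y, w', hyx, hw'.1⟩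
  exfalso
  have hyo := hyx.left_le
  have hcov := hyx.covBy hoa
  have hwy : ¬ w' ≤ y := fun h => hw'.2 (h.trans hyo)
  -- By minimality, everything strictly below w' is below o, hence below x ⊓ o = y.
  have hm : w' ⊓ y ⋖ w' := by
    refine ⟨inf_lt_left.2 hwy, fun v hv hvw => hv.not_ge ?_⟩
    have hvo : v ≤ o := by
      by_contra hvo
      exact hvw.not_ge (hmin ⟨hvw.le.trans hw'.1, hvo⟩ hvw.le)
    exact le_inf hvw.le ((le_inf (hvw.le.trans hlt.le) hvo).trans (hyx.inf_eq hoa).le)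
  have hym : w' ⊓ y < y := by
    refine inf_lt_right.2 fun h => ?_
    rcases hcov.eq_or_eq h hlt.le with e | e
    · exact hwy e.le
    · exact hlt.ne e
  -- With a lower cover c of y, the pair (c, w' ⊔ c) continues the trace and still lies above w',
  -- against the minimality of x.
  obtain ⟨c, hmc, hcy⟩ := exists_le_covBy_of_lt hym
  have hwc : ¬ w' ≤ c := fun h => hwy (h.trans hcy.le)
  have hcx : c ⋖ w' ⊔ c := CovBy.covBy_sup_of_not_le hm hmc hwc
  have hxy : ¬ w' ⊔ c ≤ y := fun h => hwy (le_sup_left.trans h)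
  have hinf : (w' ⊔ c) ⊓ y = c := CovBy.inf_eq_of_not_le hcx hcy.le hxy
  have hyx' : ¬ y ≤ w' ⊔ c := fun h => by
    rw [inf_eq_right.2 h] at hinf
    exact hcy.ne hinf.symm
  have hsup : y ⊔ (w' ⊔ c) = x := by
    refine (hcov.eq_or_eq le_sup_left
      (sup_le hcov.le (sup_le hlt.le (hcy.le.trans hcov.le)))).resolve_left fun e => ?_
    exact hxy (sup_eq_left.1 e)
  have hx'x : w' ⊔ c ⋖ x := hsup ▸ CovBy.covBy_sup_of_not_le hcy hcx.le hyx'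
  have hT : IsCoveringSquare ((w' ⊔ c) ⊓ y) (w' ⊔ c) y x :=
    ⟨by rwa [hinf], by rwa [hinf], hx'x, hcov, fun e => hxy e.le⟩
  exact hx'x.lt.not_ge (hxmin ⟨⟨_, hyx.step hT⟩, le_sup_left⟩ hx'x.le)

end ForkTrace

end Slim

/-! ### The lattice `L[S]` -/

namespace Fork

variable {L : Type*} [Lattice L] {S : CoveringSquare L}

/-- The least element of `L` above an element of `L[S]`. -/
def top : Fork S → L
  | old a => a
  | t => S.i
  | zl _ x _ => x
  | zr _ x _ => x

/-- The elements of `L[S]` below `t`. -/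
def IsLow : Fork S → Prop
  | old a => a ≤ S.o
  | t => True
  | zl _ _ _ => True
  | zr _ _ _ => True

variable (S) in
/-- The elements of `L` of the form `top u` with `u` below `t`. -/
def IsLowTop (c : L) : Prop :=
  c ≤ S.o ∨ c = S.i ∨ (∃ y, ForkTrace S.o S.al y c) ∨ ∃ y, ForkTrace S.o S.ar y c

variable (S) in
lemma o_covBy_al : S.o ⋖ S.al := S.isCoveringSquare.1

variable (S) in
lemma o_covBy_ar : S.o ⋖ S.ar := S.isCoveringSquare.2.1

variable (S) in
lemma al_covBy_i : S.al ⋖ S.i := S.isCoveringSquare.2.2.1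

variable (S) in
lemma ar_covBy_i : S.ar ⋖ S.i := S.isCoveringSquare.2.2.2.1

variable (S) in
lemma al_ne_ar : S.al ≠ S.ar := S.isCoveringSquare.2.2.2.2

variable (S) in
lemma al_inf_ar : S.al ⊓ S.ar = S.o :=
  CovBy.inf_eq_of_not_le (o_covBy_al S) (o_covBy_ar S).le
    (CovBy.not_le_of_covBy_of_ne (o_covBy_al S) (o_covBy_ar S) (al_ne_ar S))

variable (S) in
lemma al_sup_ar : S.al ⊔ S.ar = S.i := by
  refine ((al_covBy_i S).eq_or_eq le_sup_left
    (sup_le (al_covBy_i S).le (ar_covBy_i S).le)).resolve_left fun e => ?_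
  exact CovBy.not_le_of_covBy_of_ne (o_covBy_ar S) (o_covBy_al S) (al_ne_ar S).symm
    (sup_eq_left.1 e)

variable (S) in
lemma o_lt_i : S.o < S.i := (o_covBy_al S).lt.trans (al_covBy_i S).lt

lemma isLow_of_top_le {u : Fork S} (h : u.top ≤ S.o) : u.IsLow := by
  cases u with
  | old a => exact h
  | _ => trivial

lemma eq_old_of_not_isLow {u : Fork S} (h : ¬ u.IsLow) : u = old u.top := by
  cases u with
  | old a => rfl
  | _ => exact absurd trivial h

lemma eq_old_of_top_le {u : Fork S} (h : u.top ≤ S.o) : u = old u.top := by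
  cases u with
  | old a => rfl
  | t => exact absurd h (o_lt_i S).not_ge
  | zl y x k => exact absurd h (k.not_le (o_covBy_al S))
  | zr y x k => exact absurd h (k.not_le (o_covBy_ar S))

lemma IsLow.isLowTop {u : Fork S} (h : u.IsLow) : IsLowTop S u.top := by
  cases u with
  | old a => exact .inl h
  | t => exact .inr (.inl rfl)
  | zl y x k => exact .inr (.inr (.inl ⟨y, k⟩))
  | zr y x k => exact .inr (.inr (.inr ⟨y, k⟩))

lemma IsLowTop.exists {c : L} (h : IsLowTop S c) : ∃ u : Fork S, u.top = c ∧ u.IsLow := by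
  rcases h with h | rfl | ⟨y, k⟩ | ⟨y, k⟩
  · exact ⟨old c, rfl, h⟩
  · exact ⟨t, rfl, trivial⟩
  · exact ⟨zl y c k, rfl, trivial⟩
  · exact ⟨zr y c k, rfl, trivial⟩

lemma IsLowTop.le_i {c : L} (h : IsLowTop S c) : c ≤ S.i := by
  rcases h with h | rfl | ⟨y, k⟩ | ⟨y, k⟩
  · exact h.trans (o_lt_i S).le
  · exact le_rfl
  · exact k.right_le.trans (al_covBy_i S).le
  · exact k.right_le.trans (ar_covBy_i S).le

lemma trace_sup_of_le (hL : IsSPS L) {a y x c : L} (hoa : S.o ⋖ a) (h : ForkTrace S.o a y x)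
    (hc : c ≤ S.o) : ForkTrace S.o a (y ⊔ c) (c ⊔ x) := by
  have k := h.sup hL hoa le_sup_left (sup_le h.left_le hc)
  have e : y ⊔ c ⊔ x = c ⊔ x := by
    rw [sup_comm y c, sup_assoc, sup_eq_right.2 (h.covBy hoa).le]
  rwa [e] at k

lemma trace_left_sup_trace_right (hL : IsSPS L) {y x y' x' : L} (h : ForkTrace S.o S.al y x)
    (h' : ForkTrace S.o S.ar y' x') : x ⊔ x' = S.i := by
  have ho : S.o ≤ x ⊔ x' := by
    rw [← h.left_sup_left hL (o_covBy_al S) (o_covBy_ar S) (al_ne_ar S) h']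
    exact sup_le_sup (h.covBy (o_covBy_al S)).le (h'.covBy (o_covBy_ar S)).le
  apply le_antisymm (sup_le (h.right_le.trans (al_covBy_i S).le)
    (h'.right_le.trans (ar_covBy_i S).le))
  rw [← al_sup_ar]
  exact sup_le (h.le_sup.trans (sup_le ho le_sup_left)) (h'.le_sup.trans (sup_le ho le_sup_right))

lemma IsLowTop.sup (hL : IsSPS L) {c d : L} (hc : IsLowTop S c) (hd : IsLowTop S d) :
    IsLowTop S (c ⊔ d) := by
  have hci := hc.le_i
  have hdi := hd.le_i
  rcases hc with hc | rfl | ⟨y, k⟩ | ⟨y, k⟩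
  · rcases hd with hd | rfl | ⟨y', k'⟩ | ⟨y', k'⟩
    · exact .inl (sup_le hc hd)
    · exact .inr (.inl (sup_eq_right.2 hci))
    · exact .inr (.inr (.inl ⟨_, trace_sup_of_le hL (o_covBy_al S) k' hc⟩))
    · exact .inr (.inr (.inr ⟨_, trace_sup_of_le hL (o_covBy_ar S) k' hc⟩))
  · exact .inr (.inl (sup_eq_left.2 hdi))
  · rcases hd with hd | rfl | ⟨y', k'⟩ | ⟨y', k'⟩
    · rw [sup_comm]
      exact .inr (.inr (.inl ⟨_, trace_sup_of_le hL (o_covBy_al S) k hd⟩))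
    · exact .inr (.inl (sup_eq_right.2 hci))
    · exact .inr (.inr (.inl ⟨_, k.sup_sup hL (o_covBy_al S) k'⟩))
    · exact .inr (.inl (trace_left_sup_trace_right hL k k'))
  · rcases hd with hd | rfl | ⟨y', k'⟩ | ⟨y', k'⟩
    · rw [sup_comm]
      exact .inr (.inr (.inr ⟨_, trace_sup_of_le hL (o_covBy_ar S) k hd⟩))
    · exact .inr (.inl (sup_eq_right.2 hci))
    · rw [sup_comm]
      exact .inr (.inl (trace_left_sup_trace_right hL k' k))
    · exact .inr (.inr (.inr ⟨_, k.sup_sup hL (o_covBy_ar S) k'⟩))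

lemma top_le_of_step {u v : Fork S} (h : Fork.Step S u v) :
    u.top ≤ v.top ∧ (v.IsLow → u.IsLow) := by
  cases h with
  | old h => exact ⟨h, h.trans⟩
  | t_lt_i => exact ⟨le_rfl, fun _ => trivial⟩
  | zl_lt_t => exact ⟨(al_covBy_i S).le, fun _ => trivial⟩
  | zr_lt_t => exact ⟨(ar_covBy_i S).le, fun _ => trivial⟩
  | y_lt_zl h => exact ⟨(h.covBy (o_covBy_al S)).le, fun _ => h.left_le⟩
  | y_lt_zr h => exact ⟨(h.covBy (o_covBy_ar S)).le, fun _ => h.left_le⟩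
  | zl_lt_x h => exact ⟨le_rfl, fun _ => trivial⟩
  | zr_lt_x h => exact ⟨le_rfl, fun _ => trivial⟩
  | zl_lt_zl h hT => exact ⟨hT.2.2.1.le, fun _ => trivial⟩
  | zr_lt_zr h hT => exact ⟨hT.2.2.1.le, fun _ => trivial⟩

lemma zl_le_t {y x : L} (h : ForkTrace S.o S.al y x) : Fork.Le (zl y x h) t := by
  induction h with
  | base => exact .single .zl_lt_t
  | step h hT ih => exact .head (.zl_lt_zl h hT) ih

lemma zr_le_t {y x : L} (h : ForkTrace S.o S.ar y x) : Fork.Le (zr y x h) t := by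
  induction h with
  | base => exact .single .zr_lt_t
  | step h hT ih => exact .head (.zr_lt_zr h hT) ih

lemma sup_left_sup_right_eq {a y x y' x' : L} (hoa : S.o ⋖ a) (h : ForkTrace S.o a y x)
    (h' : ForkTrace S.o a y' x') (hle : x ≤ x') : y ≤ y' ∧ y' ⊔ x = x' := by
  have hy : y ≤ y' := by
    rw [← h.inf_eq hoa, ← h'.inf_eq hoa]
    exact inf_le_inf_right _ hle
  refine ⟨hy, ((h'.covBy hoa).eq_or_eq le_sup_left
    (sup_le (h'.covBy hoa).le hle)).resolve_left fun e => ?_⟩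
  exact h.not_le hoa ((sup_eq_left.1 e).trans h'.left_le)

lemma zl_le_zl (hL : IsSPS L) {y x y' x' : L} (h : ForkTrace S.o S.al y x)
    (h' : ForkTrace S.o S.al y' x') (hle : x ≤ x') : Fork.Le (zl y x h) (zl y' x' h') := by
  obtain ⟨hy, rfl⟩ := sup_left_sup_right_eq (o_covBy_al S) h h' hle
  exact (h.sup_and hL (o_covBy_al S) (fun y x y' x' h h' => Fork.Le (zl y x h) (zl y' x' h'))
    (fun _ _ _ => .refl) (fun _ _ _ _ _ h _ hT hle => .head (.zl_lt_zl h hT) hle) hy h'.left_le).2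

lemma zr_le_zr (hL : IsSPS L) {y x y' x' : L} (h : ForkTrace S.o S.ar y x)
    (h' : ForkTrace S.o S.ar y' x') (hle : x ≤ x') : Fork.Le (zr y x h) (zr y' x' h') := by
  obtain ⟨hy, rfl⟩ := sup_left_sup_right_eq (o_covBy_ar S) h h' hle
  exact (h.sup_and hL (o_covBy_ar S) (fun y x y' x' h h' => Fork.Le (zr y x h) (zr y' x' h'))
    (fun _ _ _ => .refl) (fun _ _ _ _ _ h _ hT hle => .head (.zr_lt_zr h hT) hle) hy h'.left_le).2

/-- The order of `L[S]`: `u ↦ (top u, IsLow u)` embeds `L[S]` into the product of `L` and a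
two-element chain. -/
theorem le_iff (hL : IsSPS L) (u v : Fork S) :
    Fork.Le u v ↔ u.top ≤ v.top ∧ (v.IsLow → u.IsLow) := by
  constructor
  · intro h
    induction h with
    | refl => exact ⟨le_rfl, id⟩
    | tail _ h ih =>
      have h' := top_le_of_step h
      exact ⟨ih.1.trans h'.1, fun hl => ih.2 (h'.2 hl)⟩
  · rintro ⟨h, hl⟩
    cases u with
    | old a =>
      cases v with
      | old b => exact .single (.old h)
      | t => exact .head (.old (hl trivial)) (.head (.y_lt_zl .base) (zl_le_t .base))
      | zl y x k =>
        exact .head (.old ((le_inf h (hl trivial)).trans (k.inf_eq (o_covBy_al S)).le))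
          (.single (.y_lt_zl k))
      | zr y x k =>
        exact .head (.old ((le_inf h (hl trivial)).trans (k.inf_eq (o_covBy_ar S)).le))
          (.single (.y_lt_zr k))
    | t =>
      cases v with
      | old b => exact .head .t_lt_i (.single (.old h))
      | t => exact .refl
      | zl y x k => exact absurd (h.trans k.right_le) (al_covBy_i S).lt.not_ge
      | zr y x k => exact absurd (h.trans k.right_le) (ar_covBy_i S).lt.not_ge
    | zl y x k =>
      cases v with
      | old b => exact .head (.zl_lt_x k) (.single (.old h))
      | t => exact zl_le_t k
      | zl y' x' k' => exact zl_le_zl hL k k' h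
      | zr y' x' k' =>
        refine absurd ?_ (k.not_le (o_covBy_al S))
        rw [← al_inf_ar]
        exact le_inf k.right_le (h.trans k'.right_le)
    | zr y x k =>
      cases v with
      | old b => exact .head (.zr_lt_x k) (.single (.old h))
      | t => exact zr_le_t k
      | zl y' x' k' =>
        refine absurd ?_ (k.not_le (o_covBy_ar S))
        rw [← al_inf_ar]
        exact le_inf (h.trans k'.right_le) k.right_le
      | zr y' x' k' => exact zr_le_zr hL k k' h

/-- Low elements of different kinds have different tops: below o, equal to i, below `al` but not o,
below `ar` but not o. -/
lemma ext_top {u v : Fork S} (h : u.top = v.top) (hl : u.IsLow ↔ v.IsLow) : u = v := by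
  by_cases hv : v.IsLow
  · have hu := hl.2 hv
    by_cases hc : v.top ≤ S.o
    · rw [eq_old_of_top_le hc, eq_old_of_top_le (h.trans_le hc), h]
    · have hc' : ¬ u.top ≤ S.o := h ▸ hc
      cases u with
      | old a => exact absurd hu hc'
      | t =>
        cases v with
        | old b => exact absurd hv hc
        | t => rfl
        | zl y x k => exact absurd (h.le.trans k.right_le) (al_covBy_i S).lt.not_ge
        | zr y x k => exact absurd (h.le.trans k.right_le) (ar_covBy_i S).lt.not_ge
      | zl y x k =>
        cases v with
        | old b => exact absurd hv hc
        | t => exact absurd (h.ge.trans k.right_le) (al_covBy_i S).lt.not_ge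
        | zl y' x' k' =>
          obtain rfl : x = x' := h
          obtain rfl := k.left_eq k' (o_covBy_al S)
          rfl
        | zr y' x' k' =>
          refine absurd ?_ hc'
          rw [← al_inf_ar]
          exact le_inf k.right_le (h.le.trans k'.right_le)
      | zr y x k =>
        cases v with
        | old b => exact absurd hv hc
        | t => exact absurd (h.ge.trans k.right_le) (ar_covBy_i S).lt.not_ge
        | zl y' x' k' =>
          refine absurd ?_ hc'
          rw [← al_inf_ar]
          exact le_inf (h.le.trans k'.right_le) k.right_le
        | zr y' x' k' =>
          obtain rfl : x = x' := h
          obtain rfl := k.left_eq k' (o_covBy_ar S)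
          rfl
  · rw [eq_old_of_not_isLow hv, eq_old_of_not_isLow fun hu => hv (hl.1 hu), h]

/-- `L[S]` as an ordered set. -/
@[reducible]
def partialOrder (hL : IsSPS L) : PartialOrder (Fork S) where
  le := Fork.Le
  le_refl _ := .refl
  le_trans _ _ _ := .trans
  le_antisymm u v h h' := by
    rw [le_iff hL] at h h'
    exact ext_top (le_antisymm h.1 h'.1) ⟨h'.2, h.2⟩

lemma finite (hL : IsSPS L) : Finite (Fork S) := by
  have := hL.planar.1
  refine Finite.of_injective (fun u : Fork S => (u.top, u.IsLow)) fun u v h => ?_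
  have h' := Prod.mk.inj h
  exact ext_top h'.1 (iff_of_eq h'.2)

/-- The join is low exactly when both elements are, and its top is the join of the tops;
`IsLowTop.sup` supplies the low one. -/
lemma exists_sup (hL : IsSPS L) (u v : Fork S) :
    ∃ w : Fork S, Fork.Le u w ∧ Fork.Le v w ∧ ∀ w', Fork.Le u w' → Fork.Le v w' → Fork.Le w w' := by
  simp only [le_iff hL]
  by_cases h : u.IsLow ∧ v.IsLow
  · obtain ⟨w, hw, hl⟩ := (h.1.isLowTop.sup hL h.2.isLowTop).exists
    exact ⟨w, by rw [hw]; exact ⟨le_sup_left, fun _ => h.1⟩,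
      by rw [hw]; exact ⟨le_sup_right, fun _ => h.2⟩,
      fun w' h1 h2 => by rw [hw]; exact ⟨sup_le h1.1 h2.1, fun _ => hl⟩⟩
  · refine ⟨old (u.top ⊔ v.top), ⟨le_sup_left, fun hl => isLow_of_top_le (le_sup_left.trans hl)⟩,
      ⟨le_sup_right, fun hl => isLow_of_top_le (le_sup_right.trans hl)⟩, fun w' h1 h2 =>
      ⟨sup_le h1.1 h2.1, fun hl => absurd ⟨h1.2 hl, h2.2 hl⟩ h⟩⟩

/-- A finite ordered set with binary joins and a least element is a lattice. -/
lemma exists_lattice_of_exists_sup {α : Type*} [PartialOrder α] [Finite α] {b : α}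
    (hb : ∀ x, b ≤ x) (h : ∀ u v : α, ∃ w, u ≤ w ∧ v ≤ w ∧ ∀ w', u ≤ w' → v ≤ w' → w ≤ w') :
    ∃ _ : Lattice α, ∀ u v : α, @LE.le α (Lattice.toSemilatticeInf.toLE) u v ↔ u ≤ v := by
  classical
  have hs : ∀ A : Set α, ∃ w, IsLUB A w := by
    intro A
    induction A, Set.toFinite A using Set.Finite.induction_on with
    | empty => exact ⟨b, isLUB_empty_iff.2 hb⟩
    | @insert a A _ _ ih =>
      obtain ⟨v, hv⟩ := ih
      obtain ⟨w, h1, h2, h3⟩ := h a v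
      refine ⟨w, ?_, ?_⟩
      · rintro x (rfl | hx)
        · exact h1
        · exact (hv.1 hx).trans h2
      · intro x hx
        exact h3 x (hx (.inl rfl)) (hv.2 fun y hy => hx (.inr hy))
  choose f hf using hs
  let _ : SupSet α := ⟨f⟩
  exact ⟨(completeLatticeOfSup α hf).toLattice, fun _ _ => Iff.rfl⟩

theorem exists_lattice (hL : IsSPS L) :
    ∃ _ : Lattice (Fork S), ∀ u v : Fork S, u ≤ v ↔ Fork.Le u v := by
  let _ := partialOrder (S := S) hL
  have := finite (S := S) hL
  have := hL.planar.1
  obtain ⟨m, hm⟩ := (Set.toFinite (Set.univ : Set L)).exists_minimal ⟨S.o, trivial⟩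
  have hm' : ∀ y, m ≤ y := fun y => (hm.2 trivial (inf_le_left : m ⊓ y ≤ m)).trans inf_le_right
  have hbot : ∀ u : Fork S, (old m : Fork S) ≤ u :=
    fun u => (le_iff hL _ _).2 ⟨hm' _, fun _ => hm' S.o⟩
  obtain ⟨inst, h⟩ := exists_lattice_of_exists_sup hbot (exists_sup hL)
  exact ⟨inst, h⟩

end Fork

/-! ### Congruences -/

namespace LatticeCon

variable {K : Type*} [Lattice K]

lemma con_rel (a b : K) : (con a b).r a b := fun _ hθ => hθ

lemma con_le_iff {a b : K} {θ : LatticeCon K} : con a b ≤ θ ↔ θ.r a b :=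
  ⟨fun h => h _ _ (con_rel a b), fun h _ _ hxy => hxy θ h⟩

lemma inf_right (θ : LatticeCon K) {a b : K} (h : θ.r a b) (c : K) : θ.r (a ⊓ c) (b ⊓ c) :=
  θ.inf h (θ.iseqv.refl c)

lemma sup_right (θ : LatticeCon K) {a b : K} (h : θ.r a b) (c : K) : θ.r (a ⊔ c) (b ⊔ c) :=
  θ.sup h (θ.iseqv.refl c)

/-- An equivalence relation is a congruence if it is compatible with meets and joins with a fixed
element. -/
def ofUnary (r : K → K → Prop) (hr : Equivalence r)
    (hinf : ∀ a b c, r a b → r (a ⊓ c) (b ⊓ c)) (hsup : ∀ a b c, r a b → r (a ⊔ c) (b ⊔ c)) :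
    LatticeCon K where
  r := r
  iseqv := hr
  inf {a b c d} h h' := hr.trans (hinf a b c h) (by
    rw [inf_comm b c, inf_comm b d]
    exact hinf c d b h')
  sup {a b c d} h h' := hr.trans (hsup a b c h) (by
    rw [sup_comm b c, sup_comm b d]
    exact hsup c d b h')

/-- Joins of congruences come from intersections of upper bounds; an upper bound made of finite
chains is enough to control them. -/
lemma exists_upper_bound (θ φ : LatticeCon K) : ∃ ψ : LatticeCon K, θ ≤ ψ ∧ φ ≤ ψ ∧
    ∀ a b, ψ.r a b ↔ Relation.EqvGen (fun x y => θ.r x y ∨ φ.r x y) a b := by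
  refine ⟨ofUnary (Relation.EqvGen fun x y => θ.r x y ∨ φ.r x y) (Relation.EqvGen.is_equivalence _)
    ?_ ?_, fun x y h => .rel _ _ (.inl h), fun x y h => .rel _ _ (.inr h), fun _ _ => Iff.rfl⟩
  · intro a b c h
    induction h with
    | rel x y h => exact .rel _ _ (h.imp (θ.inf_right · c) (φ.inf_right · c))
    | refl x => exact .refl _
    | symm x y _ ih => exact .symm _ _ ih
    | trans x y z _ _ ih ih' => exact .trans _ _ _ ih ih'
  · intro a b c h
    induction h with
    | rel x y h => exact .rel _ _ (h.imp (θ.sup_right · c) (φ.sup_right · c))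
    | refl x => exact .refl _
    | symm x y _ ih => exact .symm _ _ ih
    | trans x y z _ _ ih ih' => exact .trans _ _ _ ih ih'

/-- A prime interval collapsed by a join of two congruences is collapsed by one of them. -/
lemma rel_or_rel_of_covBy {p q : K} (hpq : p ⋖ q) {θ φ : LatticeCon K} (h : (θ ⊔ φ).r p q) :
    θ.r p q ∨ φ.r p q := by
  by_contra! hn
  obtain ⟨ψ, h1, h2, h3⟩ := exists_upper_bound θ φ
  -- The map x ↦ (x ⊔ p) ⊓ q has values in {p, q} and respects θ and φ. If neither collapses p and
  -- q, it is constant along chains.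
  have hf : ∀ x, (x ⊔ p) ⊓ q = p ∨ (x ⊔ p) ⊓ q = q := fun x =>
    hpq.eq_or_eq (le_inf le_sup_right hpq.le) inf_le_right
  have key : ∀ x y, Relation.EqvGen (fun x y => θ.r x y ∨ φ.r x y) x y →
      (x ⊔ p) ⊓ q = (y ⊔ p) ⊓ q := by
    intro x y h
    induction h with
    | rel x y h =>
      have h' : θ.r ((x ⊔ p) ⊓ q) ((y ⊔ p) ⊓ q) ∨ φ.r ((x ⊔ p) ⊓ q) ((y ⊔ p) ⊓ q) :=
        h.imp (fun h => θ.inf_right (θ.sup_right h p) q) (fun h => φ.inf_right (φ.sup_right h p) q)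
      rcases hf x with e | e <;> rcases hf y with e' | e' <;> rw [e, e'] at h' ⊢
      · exact (h'.elim hn.1 hn.2).elim
      · exact (h'.elim (fun h => hn.1 (θ.iseqv.symm h)) fun h => hn.2 (φ.iseqv.symm h)).elim
    | refl x => rfl
    | symm x y _ ih => exact ih.symm
    | trans x y z _ _ ih ih' => exact ih.trans ih'
  have e := key p q ((h3 p q).1 ((sup_le h1 h2 : θ ⊔ φ ≤ ψ) p q h))
  rw [sup_idem, inf_eq_left.2 hpq.le, sup_eq_left.2 hpq.le, inf_idem] at e
  exact hpq.ne e

/-- The congruence generated by a prime interval is join-irreducible. -/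
theorem supIrred_con {p q : K} (hpq : p ⋖ q) : SupIrred (con p q) := by
  constructor
  · intro hmin
    let e : LatticeCon K := ofUnary Eq eq_equivalence (fun _ _ _ h => by rw [h])
      (fun _ _ _ h => by rw [h])
    have he : e ≤ con p q := by
      rintro x _ rfl
      exact (con p q).iseqv.refl x
    exact hpq.ne (hmin he p q (con_rel p q))
  · intro θ φ h
    rcases rel_or_rel_of_covBy hpq (h ▸ con_rel p q) with h' | h'
    · exact .inl (le_antisymm (h ▸ le_sup_left) (con_le_iff.2 h'))
    · exact .inr (le_antisymm (h ▸ le_sup_right) (con_le_iff.2 h'))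

end LatticeCon

/-! ### Congruences of `L[S]` -/

namespace Fork

variable {L : Type*} [Lattice L] {S : CoveringSquare L}

variable (S) in
/-- The elements of `L` that stay closed when everything strictly below `i` is collapsed as far as
the prime intervals `[al, i]` and `[ar, i]` allow. -/
def Barrier (b : L) : Prop := ¬ b < S.i ∨ b = S.al ∨ b = S.ar

lemma le_al_or_le_ar (hL : IsSPS L) (hS : S.IsTight) {a : L} (h : a < S.i) :
    a ≤ S.al ∨ a ≤ S.ar := by
  have := hL.planar.1
  obtain ⟨c, hac, hc⟩ := exists_le_covBy_of_lt h
  rcases (hS c).1 hc with rfl | rfl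
  exacts [.inl hac, .inr hac]

lemma Barrier.eq_of_le {b : L} (h : Barrier S b) (hb : b ≤ S.al) : b = S.al := by
  rcases h with h | h | rfl
  · exact absurd (hb.trans_lt (al_covBy_i S).lt) h
  · exact h
  · exact absurd hb (CovBy.not_le_of_covBy_of_ne (o_covBy_ar S) (o_covBy_al S) (al_ne_ar S).symm)

lemma Barrier.eq_of_le' {b : L} (h : Barrier S b) (hb : b ≤ S.ar) : b = S.ar := by
  rcases h with h | rfl | h
  · exact absurd (hb.trans_lt (ar_covBy_i S).lt) h
  · exact absurd hb (CovBy.not_le_of_covBy_of_ne (o_covBy_al S) (o_covBy_ar S) (al_ne_ar S))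
  · exact h

/-- Compatibility with meets of the relation "below the same barriers". For u, v below the same
lower cover of i, the trichotomy for u ⊓ (v ⊓ w) ≤ b leaves only b below that cover, so b equals it.
-/
lemma inf_le_barrier (hL : IsSPS L) (hS : S.IsTight) {u v w b : L}
    (huv : ∀ b, Barrier S b → (u ≤ b ↔ v ≤ b)) (hb : Barrier S b) (h : u ⊓ w ≤ b) :
    v ⊓ w ≤ b := by
  have hal : Barrier S S.al := .inr (.inl rfl)
  have har : Barrier S S.ar := .inr (.inr rfl)
  have hi : Barrier S S.i := .inl (lt_irrefl _)
  by_cases hvi : v ≤ S.i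
  · have hui := (huv _ hi).2 hvi
    by_contra hvw
    have hub : ¬ u ≤ b := fun h' => hvw (inf_le_left.trans ((huv b hb).1 h'))
    have huw : u ⊓ (v ⊓ w) ≤ b := (inf_le_inf_left u inf_le_right).trans h
    rcases hL.le_or_le_or_le_sup huw with k | k | k
    · exact hub k
    · exact hvw k
    · rcases hui.eq_or_lt with e | hlt
      · have hvi' : v = S.i := by
          rcases hvi.eq_or_lt with e' | hlt'
          · exact e'
          · rcases le_al_or_le_ar hL hS hlt' with h' | h'
            · exact absurd (e ▸ (huv _ hal).2 h') (al_covBy_i S).lt.not_ge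
            · exact absurd (e ▸ (huv _ har).2 h') (ar_covBy_i S).lt.not_ge
        rw [hvi', ← e] at hvw
        exact hvw h
      · rcases le_al_or_le_ar hL hS hlt with h' | h'
        · have e := hb.eq_of_le (k.trans (sup_le h' (inf_le_left.trans ((huv _ hal).1 h'))))
          exact hub (e ▸ h')
        · have e := hb.eq_of_le' (k.trans (sup_le h' (inf_le_left.trans ((huv _ har).1 h'))))
          exact hub (e ▸ h')
  -- Outside the ideal of i, both elements are themselves barriers, so they coincide.
  · have hvu : u ≤ v := (huv v (.inl fun h' => hvi h'.le)).2 le_rfl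
    have huv' : v ≤ u := (huv u (.inl fun h' => hvi ((huv _ hi).1 h'.le))).1 le_rfl
    exact (inf_le_inf_right w huv').trans h

lemma inf_le_barrier_of_trace (hL : IsSPS L) {a b x' y w : L} (hoa : S.o ⋖ a)
    (hb : ¬ b ≤ a) (ht : ForkTrace S.o a y x') (hwa : w ≤ a) (hxb : x' ≤ b)
    (hob : S.o ⊓ w ≤ b) : w ≤ b := by
  rcases hL.le_or_le_or_le_sup hob with k | k | k
  · exact hwa.trans (ht.le_sup.trans (sup_le k hxb))
  · exact k
  · exact absurd (k.trans (sup_le hoa.le hwa)) hb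

/-! ### Meets, joins and prime intervals of L[S] -/

variable [Lattice (Fork S)]

lemma isLow_iff_le_t (hle : ∀ u v : Fork S, u ≤ v ↔ u.top ≤ v.top ∧ (v.IsLow → u.IsLow))
    (u : Fork S) : u.IsLow ↔ u ≤ t := by
  rw [hle]
  exact ⟨fun h => ⟨h.isLowTop.le_i, fun _ => h⟩, fun h => h.2 trivial⟩

lemma isLow_sup_iff (hle : ∀ u v : Fork S, u ≤ v ↔ u.top ≤ v.top ∧ (v.IsLow → u.IsLow))
    (u v : Fork S) : (u ⊔ v).IsLow ↔ u.IsLow ∧ v.IsLow := by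
  simp only [isLow_iff_le_t hle, sup_le_iff]

lemma le_old_iff (hle : ∀ u v : Fork S, u ≤ v ↔ u.top ≤ v.top ∧ (v.IsLow → u.IsLow))
    {u : Fork S} {a : L} : u ≤ old a ↔ u.top ≤ a := by
  rw [hle]
  exact ⟨fun h => h.1, fun h => ⟨h, fun h' => isLow_of_top_le (h.trans h')⟩⟩

lemma le_iff_of_isLow (hle : ∀ u v : Fork S, u ≤ v ↔ u.top ≤ v.top ∧ (v.IsLow → u.IsLow))
    {u v : Fork S} (hu : u.IsLow) : u ≤ v ↔ u.top ≤ v.top := by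
  rw [hle]
  exact ⟨fun h => h.1, fun h => ⟨h, fun _ => hu⟩⟩

lemma old_le_iff_of_not_isLow
    (hle : ∀ u v : Fork S, u ≤ v ↔ u.top ≤ v.top ∧ (v.IsLow → u.IsLow))
    {u : Fork S} (hu : ¬ u.IsLow) {a : L} : old a ≤ u ↔ a ≤ u.top := by
  rw [hle]
  exact ⟨fun h => h.1, fun h => ⟨h, fun h' => absurd h' hu⟩⟩

lemma old_inf_old (hle : ∀ u v : Fork S, u ≤ v ↔ u.top ≤ v.top ∧ (v.IsLow → u.IsLow)) (a b : L) :
    (old a ⊓ old b : Fork S) = old (a ⊓ b) := by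
  refine le_antisymm ?_ (le_inf ((le_old_iff hle).2 inf_le_left) ((le_old_iff hle).2 inf_le_right))
  rw [le_old_iff hle]
  exact le_inf ((le_old_iff hle).1 inf_le_left) ((le_old_iff hle).1 inf_le_right)

lemma old_sup_old (hle : ∀ u v : Fork S, u ≤ v ↔ u.top ≤ v.top ∧ (v.IsLow → u.IsLow)) {a b : L}
    (h : ¬ (a ≤ S.o ∧ b ≤ S.o)) : (old a ⊔ old b : Fork S) = old (a ⊔ b) := by
  refine le_antisymm
    (sup_le ((le_old_iff hle).2 le_sup_left) ((le_old_iff hle).2 le_sup_right)) ?_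
  rw [old_le_iff_of_not_isLow hle fun hl => h ((isLow_sup_iff hle (old a) (old b)).1 hl)]
  exact sup_le ((hle _ _).1 (le_sup_left : (old a : Fork S) ≤ _)).1
    ((hle _ _).1 (le_sup_right : (old b : Fork S) ≤ _)).1

/-- Hence collapsing t with i collapses every low element with its top. -/
lemma t_inf_old_top (hle : ∀ u v : Fork S, u ≤ v ↔ u.top ≤ v.top ∧ (v.IsLow → u.IsLow))
    {u : Fork S} (hu : u.IsLow) : t ⊓ old u.top = u := by
  apply le_antisymm
  · rw [hle]
    exact ⟨(le_old_iff hle).1 inf_le_right, fun _ => (isLow_iff_le_t hle _).2 inf_le_left⟩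
  · exact le_inf ((isLow_iff_le_t hle u).1 hu) ((le_old_iff hle).2 le_rfl)

lemma covBy_old_i (hle : ∀ u v : Fork S, u ≤ v ↔ u.top ≤ v.top ∧ (v.IsLow → u.IsLow)) {a : L}
    (ha : S.o ⋖ a) (hai : a ⋖ S.i) : (old a : Fork S) ⋖ old S.i := by
  refine ⟨lt_of_le_of_ne ((le_old_iff hle).2 hai.le) (by simpa using hai.ne), fun v hv hvi => ?_⟩
  have hvl : ¬ v.IsLow := fun h => ha.lt.not_ge (((hle _ _).1 hv.le).2 h)
  have hv' := eq_old_of_not_isLow hvl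
  rcases hai.eq_or_eq ((hle _ _).1 hv.le).1 ((hle _ _).1 hvi.le).1 with e | e
  · exact hv.ne (by rw [hv', e])
  · exact hvi.ne (by rw [hv', e])

lemma t_covBy_old_i (hle : ∀ u v : Fork S, u ≤ v ↔ u.top ≤ v.top ∧ (v.IsLow → u.IsLow)) :
    (t : Fork S) ⋖ old S.i := by
  refine ⟨lt_of_le_of_ne ((le_old_iff hle).2 le_rfl) (by simp), fun v hv hvi => ?_⟩
  have hvl : ¬ v.IsLow := fun h => hv.not_ge ((isLow_iff_le_t hle v).1 h)
  exact hvi.not_ge ((old_le_iff_of_not_isLow hle hvl).2 ((hle _ _).1 hv.le).1)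

/-- Let z be the low element with top b. Meeting a ≡ i with b gives o ≡ b, meeting with t gives o ≡
z, and joining z ≡ b with t gives t ≡ i. -/
lemma rel_t_i_of_rel (hle : ∀ u v : Fork S, u ≤ v ↔ u.top ≤ v.top ∧ (v.IsLow → u.IsLow))
    {θ : LatticeCon (Fork S)} {a b : L} (ha : S.o ⋖ a) (hb : S.o ⋖ b) (hab : a ≠ b)
    (hbi : b ⋖ S.i) (hbt : IsLowTop S b) (h : θ.r (old a) (old S.i)) : θ.r t (old S.i) := by
  obtain ⟨z, hz, hzl⟩ := hbt.exists
  have e1 : a ⊓ b = S.o :=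
    CovBy.inf_eq_of_not_le ha hb.le (CovBy.not_le_of_covBy_of_ne ha hb hab)
  have h1 : θ.r (old S.o) (old b) := by
    have := θ.inf_right h (old b)
    rwa [old_inf_old hle, old_inf_old hle, e1, inf_eq_right.2 hbi.le] at this
  have h2 : θ.r (old S.o) z := by
    have := θ.inf_right h1 t
    have e2 : (old S.o : Fork S) ⊓ t = old S.o := inf_eq_left.2 ((isLow_iff_le_t hle _).1 le_rfl)
    have e3 : (old b : Fork S) ⊓ t = z := by
      rw [inf_comm, ← hz]
      exact t_inf_old_top hle hzl
    rwa [e2, e3] at this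
  have h3 := θ.sup_right (θ.iseqv.trans (θ.iseqv.symm h2) h1) t
  have e4 : z ⊔ t = t := sup_eq_right.2 ((isLow_iff_le_t hle z).1 hzl)
  have e5 : (old b : Fork S) ⊔ t = old S.i := by
    apply le_antisymm (sup_le ((le_old_iff hle).2 hbi.le) ((le_old_iff hle).2 le_rfl))
    rw [old_le_iff_of_not_isLow hle fun hl => hb.lt.not_ge ((isLow_sup_iff hle (old b) t).1 hl).1]
    exact ((hle _ _).1 (le_sup_right : (t : Fork S) ≤ _)).1
  rwa [e4, e5] at h3

/-! ### The congruence given by the barriers -/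

/-- The top of a meet can be smaller than the meet w of the tops, but barriers do not see the
difference. If w < i and w is not below o, then o ⊓ w and a trace element below w are tops of low
elements below the meet, and together they force w ≤ b. -/
lemma top_inf_le_barrier_of_le (hL : IsSPS L) (hS : S.IsTight)
    (hle : ∀ u v : Fork S, u ≤ v ↔ u.top ≤ v.top ∧ (v.IsLow → u.IsLow)) {u v : Fork S} {b : L}
    (hu : u.IsLow) (hb : Barrier S b) (h : (u ⊓ v).top ≤ b) : u.top ⊓ v.top ≤ b := by
  have low : ∀ w : Fork S, w.IsLow → w.top ≤ u.top ⊓ v.top → w.top ≤ b := by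
    intro w hw hwt
    have hwu : w ≤ u ⊓ v := le_inf ((le_iff_of_isLow hle hw).2 (hwt.trans inf_le_left))
      ((le_iff_of_isLow hle hw).2 (hwt.trans inf_le_right))
    exact ((hle _ _).1 hwu).1.trans h
  have ho : S.o ⊓ (u.top ⊓ v.top) ≤ b := low (old _) inf_le_left inf_le_right
  have hui := hu.isLowTop.le_i
  rcases (inf_le_left.trans hui : u.top ⊓ v.top ≤ S.i).eq_or_lt with e | hlt
  · exact low u hu (hui.trans e.ge) |>.trans' inf_le_left
  by_cases hwo : u.top ⊓ v.top ≤ S.o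
  · exact low (old _) hwo le_rfl
  rcases le_al_or_le_ar hL hS hlt with hwa | hwa
  · obtain ⟨y, x, k, hxw⟩ := ForkTrace.exists_le hL (o_covBy_al S) hwa hwo
    have hxb := low (zl y x k) trivial hxw
    by_cases hba : b ≤ S.al
    · exact (hb.eq_of_le hba) ▸ hwa
    · exact inf_le_barrier_of_trace hL (o_covBy_al S) hba k hwa hxb ho
  · obtain ⟨y, x, k, hxw⟩ := ForkTrace.exists_le hL (o_covBy_ar S) hwa hwo
    have hxb := low (zr y x k) trivial hxw
    by_cases hba : b ≤ S.ar
    · exact (hb.eq_of_le' hba) ▸ hwa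
    · exact inf_le_barrier_of_trace hL (o_covBy_ar S) hba k hwa hxb ho

lemma top_inf_le_barrier_iff (hL : IsSPS L) (hS : S.IsTight)
    (hle : ∀ u v : Fork S, u ≤ v ↔ u.top ≤ v.top ∧ (v.IsLow → u.IsLow)) {u v : Fork S} {b : L}
    (hb : Barrier S b) : (u ⊓ v).top ≤ b ↔ u.top ⊓ v.top ≤ b := by
  constructor
  · intro h
    by_cases hu : u.IsLow
    · exact top_inf_le_barrier_of_le hL hS hle hu hb h
    by_cases hv : v.IsLow
    · rw [inf_comm] at h ⊢
      exact top_inf_le_barrier_of_le hL hS hle hv hb h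
    · rwa [eq_old_of_not_isLow hu, eq_old_of_not_isLow hv, old_inf_old hle] at h
  · exact fun h => (le_inf ((hle _ _).1 inf_le_left).1 ((hle _ _).1 inf_le_right).1).trans h

/-- The congruence `con(t, i)` collapses neither `[al, i]` nor `[ar, i]`. -/
theorem not_con_rel (hL : IsSPS L) (hS : S.IsTight)
    (hle : ∀ u v : Fork S, u ≤ v ↔ u.top ≤ v.top ∧ (v.IsLow → u.IsLow)) :
    ¬ (LatticeCon.con t (old S.i)).r (old S.al : Fork S) (old S.i) ∧
      ¬ (LatticeCon.con t (old S.i)).r (old S.ar : Fork S) (old S.i) := by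
  let G : LatticeCon (Fork S) := LatticeCon.ofUnary
    (fun u v => ∀ b, Barrier S b → (u.top ≤ b ↔ v.top ≤ b))
    ⟨fun _ _ _ => Iff.rfl, fun h b hb => (h b hb).symm, fun h h' b hb => (h b hb).trans (h' b hb)⟩
    (fun u v w h b hb => by
      rw [top_inf_le_barrier_iff hL hS hle hb, top_inf_le_barrier_iff hL hS hle hb]
      exact ⟨inf_le_barrier hL hS h hb, inf_le_barrier hL hS (fun b hb => (h b hb).symm) hb⟩)
    (fun u v w h b hb => by
      rw [← le_old_iff hle, ← le_old_iff hle, sup_le_iff, sup_le_iff, le_old_iff hle,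
        le_old_iff hle, le_old_iff hle, h b hb])
  have hG : LatticeCon.con t (old S.i) ≤ G := LatticeCon.con_le_iff.2 fun b _ => Iff.rfl
  exact ⟨fun h => (al_covBy_i S).lt.not_ge ((hG _ _ h S.al (.inr (.inl rfl))).1 le_rfl),
    fun h => (ar_covBy_i S).lt.not_ge ((hG _ _ h S.ar (.inr (.inr rfl))).1 le_rfl)⟩

/-! ### Join-irreducible congruences above con(t, i) -/

lemma rel_of_rel_o (hle : ∀ u v : Fork S, u ≤ v ↔ u.top ≤ v.top ∧ (v.IsLow → u.IsLow))
    {δ : LatticeCon (Fork S)} {a b : L} (ha : S.o ⋖ a) (hb : S.o ⋖ b) (hab : a ⊔ b = S.i)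
    {e : Fork S} (he : ¬ e.IsLow) (hae : a ≤ e.top) (h : δ.r (old S.o) e) :
    δ.r (old b) (old S.i) := by
  have h1 := δ.inf_right h (old a)
  have hae' : old a ≤ e := (old_le_iff_of_not_isLow hle he).2 hae
  rw [old_inf_old hle, inf_eq_left.2 ha.le, inf_eq_right.2 hae'] at h1
  have h2 := δ.sup_right h1 (old b)
  rwa [old_sup_old hle fun h => hb.lt.not_ge h.2, old_sup_old hle fun h => hb.lt.not_ge h.2,
    sup_eq_right.2 hb.le, hab] at h2

/-- A congruence that collapses neither `[al, i]` nor `[ar, i]` separates the elements below `o`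
from those not below `t`. -/
lemma not_rel_of_top_le (hL : IsSPS L)
    (hle : ∀ u v : Fork S, u ≤ v ↔ u.top ≤ v.top ∧ (v.IsLow → u.IsLow))
    {δ : LatticeCon (Fork S)} (hl : ¬ δ.r (old S.al) (old S.i)) (hr : ¬ δ.r (old S.ar) (old S.i))
    {c d : Fork S} (hc : c.top ≤ S.o) (hd : ¬ d.IsLow) : ¬ δ.r c d := by
  intro h
  have h1 := δ.sup_right h (old S.o)
  rw [sup_eq_right.2 ((le_old_iff hle).2 hc)] at h1
  have he : ¬ (d ⊔ old S.o).IsLow := fun h => hd ((isLow_sup_iff hle _ _).1 h).1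
  have hoe : S.o < (d ⊔ old S.o).top := by
    refine lt_of_le_of_ne ((hle _ _).1 (le_sup_right : (old S.o : Fork S) ≤ _)).1 fun e => ?_
    exact he (isLow_of_top_le e.ge)
  obtain ⟨c, hoc, hce⟩ := hL.exists_covBy_le_of_lt hoe
  -- The covers of o in L are only `al` and `ar`, so d ⊔ o is above one of them.
  rcases hL.eq_or_eq_or_eq_of_covBy (o_covBy_al S) (o_covBy_ar S) hoc with e | e | e
  · exact al_ne_ar S e
  · exact hr (rel_of_rel_o hle (o_covBy_al S) (o_covBy_ar S) (al_sup_ar S) he (e ▸ hce) h1)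
  · exact hl (rel_of_rel_o hle (o_covBy_ar S) (o_covBy_al S) (sup_comm _ _ |>.trans (al_sup_ar S))
      he (e ▸ hce) h1)

/-- A join-irreducible congruence collapsing `[t, i]` but neither `[al, i]` nor `[ar, i]` equals
`con(t, i)`. -/
theorem eq_con_of_supIrred (hL : IsSPS L)
    (hle : ∀ u v : Fork S, u ≤ v ↔ u.top ≤ v.top ∧ (v.IsLow → u.IsLow))
    {δ : LatticeCon (Fork S)} (hδ : SupIrred δ) (ht : δ.r t (old S.i))
    (hl : ¬ δ.r (old S.al) (old S.i)) (hr : ¬ δ.r (old S.ar) (old S.i)) :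
    δ = LatticeCon.con t (old S.i) := by
  have sep : ∀ {u v w : Fork S}, δ.r u v → (u.IsLow ↔ v.IsLow) → (u ⊓ w).IsLow →
      (v ⊓ w).IsLow := by
    intro u v w h huv hlow
    by_contra hn
    have hv : ¬ v.IsLow := fun h' => hn (((hle _ _).1 inf_le_left).2 h')
    have hw : ¬ w.IsLow := fun h' => hn (((hle _ _).1 inf_le_right).2 h')
    have hu : ¬ u.IsLow := fun h' => hv (huv.1 h')
    -- Two elements that are not low have a low meet only if the top of this meet is below o; such
    -- an element is δ-separated from all that are not low.
    by_cases hc : (u ⊓ w).top ≤ S.o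
    · exact not_rel_of_top_le hL hle hl hr hc hn (δ.inf_right h w)
    · have h1 : old (u ⊓ w).top ≤ u :=
        (old_le_iff_of_not_isLow hle hu).2 ((hle _ _).1 inf_le_left).1
      have h2 : old (u ⊓ w).top ≤ w :=
        (old_le_iff_of_not_isLow hle hw).2 ((hle _ _).1 inf_le_right).1
      exact hc (((hle _ _).1 (le_inf h1 h2)).2 hlow)
  let R : LatticeCon (Fork S) := LatticeCon.ofUnary
    (fun u v => δ.r u v ∧ (u.IsLow ↔ v.IsLow))
    ⟨fun u => ⟨δ.iseqv.refl u, Iff.rfl⟩, fun h => ⟨δ.iseqv.symm h.1, h.2.symm⟩,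
      fun h h' => ⟨δ.iseqv.trans h.1 h'.1, h.2.trans h'.2⟩⟩
    (fun u v w h => ⟨δ.inf_right h.1 w, sep h.1 h.2, sep (δ.iseqv.symm h.1) h.2.symm⟩)
    (fun u v w h => ⟨δ.sup_right h.1 w, by rw [isLow_sup_iff hle, isLow_sup_iff hle, h.2]⟩)
  have hR : R ≤ δ := fun _ _ h => h.1
  have hγ : LatticeCon.con t (old S.i) ≤ δ := LatticeCon.con_le_iff.2 ht
  have key : ∀ u v : Fork S, u ≤ v → δ.r u v → (R ⊔ LatticeCon.con t (old S.i)).r u v := by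
    intro u v huv h
    by_cases hiff : u.IsLow ↔ v.IsLow
    · exact (le_sup_left : R ≤ R ⊔ LatticeCon.con t (old S.i)) u v ⟨h, hiff⟩
    have hv : ¬ v.IsLow := fun hv => hiff ⟨fun _ => hv, fun _ => ((hle _ _).1 huv).2 hv⟩
    have hu : u.IsLow := by
      by_contra hu
      exact hiff ⟨fun h => absurd h hu, fun h => absurd h hv⟩
    have huo : ¬ u.top ≤ S.o := fun hc => not_rel_of_top_le hL hle hl hr hc hv h
    -- A pair across the cut splits at `old u.top`: con(t, i) raises u to it, and from there to v no
    -- cut is crossed, since u.top is not below o.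
    have h1 : (LatticeCon.con t (old S.i)).r u (old u.top) := by
      have := (LatticeCon.con t (old S.i)).inf_right
        (LatticeCon.con_rel (t : Fork S) (old S.i)) (old u.top)
      rwa [t_inf_old_top hle hu, old_inf_old hle, inf_eq_right.2 hu.isLowTop.le_i] at this
    have h2 : R.r (old u.top) v := by
      have h3 := δ.sup_right h (old u.top)
      rw [sup_eq_right.2 ((le_old_iff hle).2 le_rfl), sup_eq_left.2
        ((old_le_iff_of_not_isLow hle hv).2 ((hle _ _).1 huv).1)] at h3
      exact ⟨h3, fun h => absurd h huo, fun h => absurd h hv⟩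
    exact (R ⊔ LatticeCon.con t (old S.i)).iseqv.trans
      ((le_sup_right : _ ≤ R ⊔ LatticeCon.con t (old S.i)) _ _ h1)
      ((le_sup_left : R ≤ R ⊔ LatticeCon.con t (old S.i)) _ _ h2)
  have heq : R ⊔ LatticeCon.con t (old S.i) = δ := by
    refine le_antisymm (sup_le hR hγ) fun u v h => ?_
    have hu : δ.r u (u ⊔ v) := by
      simpa [sup_comm] using δ.sup_right h u
    have hv : δ.r v (u ⊔ v) := δ.iseqv.trans (δ.iseqv.symm h) hu
    exact (R ⊔ LatticeCon.con t (old S.i)).iseqv.trans (key _ _ le_sup_left hu)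
      ((R ⊔ LatticeCon.con t (old S.i)).iseqv.symm (key _ _ le_sup_right hv))
  rcases hδ.2 heq with e | e
  · exfalso
    rw [← e] at ht
    exact (o_lt_i S).not_ge (ht.2.1 trivial)
  · exact e.symm

end Fork

/-! ### The covers of con(t, i) -/

/-- In an ordered set, if `g < a`, `g < b` and every element above `g` is above `a` or `b`, then the
covers of `g` are the minimal elements of `{a, b}`. -/
lemma setOf_covBy_eq_setOf_minimal {α : Type*} [PartialOrder α] {g a b : α} (ha : g < a)
    (hb : g < b) (h : ∀ d, g < d → a ≤ d ∨ b ≤ d) :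
    {d | g ⋖ d} = {d | Minimal (· ∈ ({a, b} : Set α)) d} := by
  ext d
  constructor
  · intro hd
    have hmem : d = a ∨ d = b := by
      rcases h d hd.lt with h' | h'
      · exact .inl ((h'.eq_of_not_lt (hd.2 ha)).symm)
      · exact .inr ((h'.eq_of_not_lt (hd.2 hb)).symm)
    refine ⟨hmem, ?_⟩
    rintro c (rfl | rfl) hc
    · exact (hc.eq_of_not_lt (hd.2 ha)).ge
    · exact (hc.eq_of_not_lt (hd.2 hb)).ge
  · rintro ⟨hd, hmin⟩
    refine ⟨by rcases hd with rfl | rfl <;> assumption, fun c hgc hcd => ?_⟩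
    rcases h c hgc with h' | h'
    · exact hcd.not_ge ((hmin (.inl rfl) (h'.trans hcd.le)).trans h')
    · exact hcd.not_ge ((hmin (.inr rfl) (h'.trans hcd.le)).trans h')

lemma ncard_setOf_minimal_pair {α : Type*} [PartialOrder α] (a b : α) :
    {d | Minimal (· ∈ ({a, b} : Set α)) d}.ncard = 1 ∨
      {d | Minimal (· ∈ ({a, b} : Set α)) d}.ncard = 2 := by
  have hsub : {d | Minimal (· ∈ ({a, b} : Set α)) d} ⊆ {a, b} := fun d hd => hd.1
  have hfin : ({a, b} : Set α).Finite := Set.toFinite _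
  have h2 := (Set.ncard_le_ncard hsub hfin).trans (Set.ncard_insert_le a {b})
  obtain ⟨m, hm⟩ := hfin.exists_minimal ⟨a, .inl rfl⟩
  have h1 := (Set.ncard_pos (hfin.subset hsub)).2 ⟨m, hm⟩
  rw [Set.ncard_singleton] at h2
  omega

theorem corollaryC {L : Type*} [Lattice L] (hL : IsSPS L) (S : CoveringSquare L)
    (hS : S.IsTight) :
    ∃ _ : Lattice (Fork S), (∀ u v : Fork S, u ≤ v ↔ Fork.Le u v) ∧
      ∃ γ αl αr : JiCon (Fork S),
        γ.1 = LatticeCon.con Fork.t (Fork.old S.i) ∧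
        αl.1 = LatticeCon.con (Fork.old S.al) (Fork.old S.i) ∧
        αr.1 = LatticeCon.con (Fork.old S.ar) (Fork.old S.i) ∧
        {δ : JiCon (Fork S) | γ ⋖ δ} = {δ | Minimal (· ∈ ({αl, αr} : Set (JiCon (Fork S)))) δ} ∧
        ({δ : JiCon (Fork S) | γ ⋖ δ}.ncard = 1 ∨ {δ : JiCon (Fork S) | γ ⋖ δ}.ncard = 2) := by
  obtain ⟨inst, hinst⟩ := Fork.exists_lattice (S := S) hL
  have hle : ∀ u v : Fork S, u ≤ v ↔ u.top ≤ v.top ∧ (v.IsLow → u.IsLow) :=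
    fun u v => (hinst u v).trans (Fork.le_iff hL u v)
  let γ : JiCon (Fork S) := ⟨_, LatticeCon.supIrred_con (Fork.t_covBy_old_i hle)⟩
  let αl : JiCon (Fork S) :=
    ⟨_, LatticeCon.supIrred_con (Fork.covBy_old_i hle (Fork.o_covBy_al S) (Fork.al_covBy_i S))⟩
  let αr : JiCon (Fork S) :=
    ⟨_, LatticeCon.supIrred_con (Fork.covBy_old_i hle (Fork.o_covBy_ar S) (Fork.ar_covBy_i S))⟩
  obtain ⟨hnl, hnr⟩ := Fork.not_con_rel hL hS hle
  have hl : γ < αl := by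
    refine lt_of_le_not_ge (LatticeCon.con_le_iff.2 ?_) fun h => hnl (LatticeCon.con_le_iff.1 h)
    exact Fork.rel_t_i_of_rel hle (Fork.o_covBy_al S) (Fork.o_covBy_ar S) (Fork.al_ne_ar S)
      (Fork.ar_covBy_i S) (.inr (.inr (.inr ⟨_, .base⟩))) (LatticeCon.con_rel _ _)
  have hr : γ < αr := by
    refine lt_of_le_not_ge (LatticeCon.con_le_iff.2 ?_) fun h => hnr (LatticeCon.con_le_iff.1 h)
    exact Fork.rel_t_i_of_rel hle (Fork.o_covBy_ar S) (Fork.o_covBy_al S) (Fork.al_ne_ar S).symm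
      (Fork.al_covBy_i S) (.inr (.inr (.inl ⟨_, .base⟩))) (LatticeCon.con_rel _ _)
  have hcov := setOf_covBy_eq_setOf_minimal hl hr fun δ hδ => by
    by_contra! hn
    refine hδ.ne (Subtype.ext (Fork.eq_con_of_supIrred hL hle δ.2
      (LatticeCon.con_le_iff.1 hδ.le) ?_ ?_).symm)
    · exact fun h => hn.1 (LatticeCon.con_le_iff.2 h)
    · exact fun h => hn.2 (LatticeCon.con_le_iff.2 h)
  refine ⟨inst, hinst, γ, αl, αr, rfl, rfl, rfl, hcov, ?_⟩
  rw [hcov]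
  exact ncard_setOf_minimal_pair αl αr
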